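/- **Setting.** Let $k(x,y)=e^{-\|x-y\|_2^2}$ be the Gaussian kernel on $\mathbb R^d$. An *$\alpha$-approximate $(Q,R,S)$-locality sensitive quantization (LSQ) family* for $k$ over points of $D\subseteq\mathbb R^d$ is a probability distribution $\mathcal Q$ over pairs $(f,g)$ of maps $f,g:\mathbb R^d\to[-R,R]^Q$ such that, for every pair and all $x,y\in\mathbb R^d$, each of $f(x)$ and $g(y)$ has at most $S$ non-zero entries, and such that $|k(x,y)-\mathbb E_{(f,g)\sim\mathcal Q}[f(x)^Tg(y)]|\le\alpha$ for all $x,y\in D$. For a closed Euclidean ball $\mathcal B\subset\mathbb R^d$ of radius $\Phi>0$ (with any center $p$) and an integer $\rho\ge 0$, let $\mathcal G_{\mathcal B}$ be the set of cells $H=\prod_{j=1}^d[m_j,m_j+1)$, $m\in\mathbb Z^d$, that intersect $\mathcal B$, let $z^H$ be the center of $H$, and let $h_r(t)=(-1)^r\frac{d^r}{dt^r}e^{-t^2}$. The *Fast Gauss Transform pair* $(f,g)$ has its coordinates indexed by $(H,r)\in\mathcal G_{\mathcal B}\times\{0,\dots,\rho\}^d$, with $$f_{H,r}(x)=\begin{cases}\prod_{j=1}^d(x_j-z^H_j)^{r_j}&x\in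 H\\0&\text{otherwise,}\end{cases}\qquad g_{H,r}(y)=\begin{cases}\prod_{j=1}^d\frac1{r_j!}h_{r_j}(y_j-z^H_j)&\|y-z^H\|_2^2\le\rho\\0&\text{otherwise.}\end{cases}$$ Time is the number of steps on a real RAM (exact real arithmetic, comparisons, $\exp$ and rounding down at unit cost). A program gets the evaluation point, $p$, $\Phi$ and $\rho$ as input and outputs a vector in sparse form: a list of (cell, multi-index, value) without repetitions that contains all non-zero entries. **Proposition.** There are programs $F,G$ and constants $\alpha_0,B>0$ such that for every $c>0$ there is $C>0$ (depending only on $c$) with the following property. Let $d\ge1$ and $0<\alpha<\alpha_0$ with $d\le c\log(1/\alpha)$. Then there is an integer $0\le\rho\le C\log(1/\alpha)$ such that for every closed ball $\mathcal B\subset\mathbb R^d$ of radius $\Phi>0$, the distribution supported on the single Fast Gauss Transform pair $(f,g)$ for $\mathcal B$ and $\rho$ is an $\alpha$-approximate $(Q,R,S)$-LSQ family for the Gaussian kernel over points of $\mathcal B$, with $$Q\le\Big(C\big(1+\tfrac{\Phi}{\sqrt d}\big)\log\tfrac1\alpha\Big)^d,\qquad 0<R\le B^d,\qquad S\le\big(\log\tfrac1\alpha\big)^{Cd}.$$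 Furthermore, for all $x,y\in\mathbb R^d$, $F$ computes $f(x)$ and $G$ computes $g(y)$, each in at most $(\log\frac1\alpha)^{Cd}$ steps. -/

import Mathlib

open MeasureTheory

/-! ### Kernels and locality sensitive quantization -/

/-- The Gaussian kernel (of unit bandwidth) `k(x, y) = exp (-‖x - y‖₂²)` on `ℝ^d`. -/
noncomputable def gaussianKernel {d : ℕ} (x y : EuclideanSpace ℝ (Fin d)) : ℝ :=
  Real.exp (-‖x - y‖ ^ 2)

/-- A pair `(f, g)` of maps `E → [-R, R]^ι` such that every vector `f x` and every vector `g y`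
has at most `S` non-zero entries. -/
structure LSQPair (E ι : Type*) (R : ℝ) (S : ℕ) where
  f : E → ι → ℝ
  g : E → ι → ℝ
  f_mem : ∀ x i, f x i ∈ Set.Icc (-R) R
  g_mem : ∀ y i, g y i ∈ Set.Icc (-R) R
  f_sparse : ∀ x, {i | f x i ≠ 0}.encard ≤ S
  g_sparse : ∀ y, {i | g y i ≠ 0}.encard ≤ S

/-- The σ-algebra on pairs generated by all evaluations `(f, g) ↦ f x i` and `(f, g) ↦ g y i`. -/
instance {E ι : Type*} {R : ℝ} {S : ℕ} : MeasurableSpace (LSQPair E ι R S) :=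
  MeasurableSpace.comap (fun P => (P.f, P.g)) inferInstance

/-- The distribution `μ` over pairs `(f, g)` is an `α`-approximate `(Q, R, S)`-LSQ family for the
kernel `k` over points of `D`. The `Q` coordinates of the vectors are indexed by the type `ι`. -/
structure IsLSQFamily {E ι : Type*} [Fintype ι] {R : ℝ} {S : ℕ} (α : ℝ) (Q : ℕ)
    (k : E → E → ℝ) (D : Set E) (μ : Measure (LSQPair E ι R S)) : Prop where
  prob : IsProbabilityMeasure μ
  range_pos : 0 < R
  card_eq : Fintype.card ι = Q
  approx : ∀ x ∈ D, ∀ y ∈ D, |k x y - ∫ P, P.f x ⬝ᵥ P.g y ∂μ| ≤ α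

/-! ### The Fast Gauss Transform pair -/

/-- The Hermite function `h_r(t) = (-1)^r ξ^{(r)}(t)`, where `ξ(t) = exp (-t²)`. -/
noncomputable def hermiteFun (r : ℕ) (t : ℝ) : ℝ :=
  (-1) ^ r * iteratedDeriv r (fun s : ℝ => Real.exp (-s ^ 2)) t

/-- The cell `∏ⱼ [mⱼ, mⱼ + 1)` of the unit grid with nodes `ℤ^d`. Cells are half-open, so that
every point lies in exactly one of them. -/
def gridCell {d : ℕ} (m : Fin d → ℤ) : Set (EuclideanSpace ℝ (Fin d)) :=
  {x | ∀ j, (m j : ℝ) ≤ x j ∧ x j < m j + 1}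

/-- The center of a grid cell. -/
noncomputable def cellCenter {d : ℕ} (m : Fin d → ℤ) : EuclideanSpace ℝ (Fin d) :=
  WithLp.toLp 2 (fun j => (m j : ℝ) + 1 / 2)

/-- The grid cells (given by their lowest corners) that intersect the closed ball of radius `Φ`
around `p`. -/
def ballCells {d : ℕ} (p : EuclideanSpace ℝ (Fin d)) (Φ : ℝ) : Set (Fin d → ℤ) :=
  {m | (gridCell m ∩ Metric.closedBall p Φ).Nonempty}

theorem ballCells_finite {d : ℕ} (p : EuclideanSpace ℝ (Fin d)) (Φ : ℝ) :
    (ballCells p Φ).Finite := by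
  refine (Set.finite_Icc (fun j => ⌊p j - Φ⌋ - 1) (fun j => ⌈p j + Φ⌉)).subset ?_
  rintro m ⟨x, hx, hb⟩
  have key : ∀ j, |x j - p j| ≤ Φ := by
    intro j
    have h1 := PiLp.norm_apply_le (x - p) j
    have h2 : ‖x - p‖ ≤ Φ := by simpa [dist_eq_norm] using hb
    simpa using h1.trans h2
  constructor
  · intro j
    have h := abs_le.1 (key j)
    have h3 : (⌊p j - Φ⌋ : ℝ) ≤ p j - Φ := Int.floor_le _
    have h4 := (hx j).2
    have h5 : ((⌊p j - Φ⌋ - 1 : ℤ) : ℝ) ≤ (m j : ℝ) := by push_cast; linarith [h.1]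
    exact_mod_cast h5
  · intro j
    have h := abs_le.1 (key j)
    have h3 : p j + Φ ≤ (⌈p j + Φ⌉ : ℝ) := Int.le_ceil _
    have h4 := (hx j).1
    have h5 : (m j : ℝ) ≤ (⌈p j + Φ⌉ : ℝ) := by linarith [h.2]
    exact_mod_cast h5

noncomputable instance {d : ℕ} (p : EuclideanSpace ℝ (Fin d)) (Φ : ℝ) :
    Fintype (ballCells p Φ) :=
  (ballCells_finite p Φ).fintype

/-- The coordinates of the Fast Gauss Transform pair: a cell `H` that intersects the ball, and a
multi-index `r ∈ {0, …, ρ}^d`. -/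
abbrev FGTIndex {d : ℕ} (p : EuclideanSpace ℝ (Fin d)) (Φ : ℝ) (ρ : ℕ) : Type :=
  ballCells p Φ × (Fin d → Fin (ρ + 1))

open Classical in
/-- `f_{H,r}(x) = ∏ⱼ (xⱼ - z^H_j)^{rⱼ}` if `x ∈ H`, and `0` otherwise. -/
noncomputable def fgtF {d : ℕ} (p : EuclideanSpace ℝ (Fin d)) (Φ : ℝ) (ρ : ℕ)
    (x : EuclideanSpace ℝ (Fin d)) (i : FGTIndex p Φ ρ) : ℝ :=
  if x ∈ gridCell i.1.1 then ∏ j, (x j - cellCenter i.1.1 j) ^ (i.2 j : ℕ) else 0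

open Classical in
/-- `g_{H,r}(y) = ∏ⱼ h_{rⱼ}(yⱼ - z^H_j) / rⱼ!` if `‖y - z^H‖² ≤ ρ`, and `0` otherwise. -/
noncomputable def fgtG {d : ℕ} (p : EuclideanSpace ℝ (Fin d)) (Φ : ℝ) (ρ : ℕ)
    (y : EuclideanSpace ℝ (Fin d)) (i : FGTIndex p Φ ρ) : ℝ :=
  if ‖y - cellCenter i.1.1‖ ^ 2 ≤ ρ then
    ∏ j, 1 / ((i.2 j : ℕ).factorial : ℝ) * hermiteFun (i.2 j) (y j - cellCenter i.1.1 j)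
  else 0

/-! ### Programs over the reals, with a step count

The model is a real RAM (exact real arithmetic, comparisons, `exp` and rounding down at unit
cost), programmed in a small first-order language with bounded loops. Values are integers, reals,
pairs and immutable linked lists; pairs and lists are handled through pointers, so that each
construct below is executed in constant time, apart from the time for its sub-programs. -/

/-- Types of values. -/
inductive Ty : Type
  | int : Ty
  | real : Ty
  | prod : Ty → Ty → Ty
  | list : Ty → Ty

/-- The values of a type. -/
@[reducible] def Ty.Val : Ty → Type
  | .int => ℤ
  | .real => ℝ
  | .prod a b => a.Val × b.Val
  | .list a => List a.Val

/-- `Var Γ a`: a variable of type `a` among variables of types `Γ`. -/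
inductive Var : List Ty → Ty → Type
  | zero {Γ : List Ty} {a : Ty} : Var (a :: Γ) a
  | succ {Γ : List Ty} {a b : Ty} : Var Γ a → Var (b :: Γ) a

/-- Assignments of values to variables of types `Γ`. -/
@[reducible] def Env : List Ty → Type
  | [] => Unit
  | a :: Γ => a.Val × Env Γ

/-- The value of a variable. -/
def Var.get : {Γ : List Ty} → {a : Ty} → Var Γ a → Env Γ → a.Val
  | _, _, .zero, γ => γ.1
  | _, _, .succ v, γ => v.get γ.2

/-- Programs that return a value of type `a`, with free variables of types `Γ`. In `letIn`,
`caseList`, `fold` and `iter`, the last argument may use one or two additional variables, placed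
in front. -/
inductive Prog : List Ty → Ty → Type
  | var {Γ : List Ty} {a : Ty} : Var Γ a → Prog Γ a
  | letIn {Γ : List Ty} {a b : Ty} : Prog Γ a → Prog (a :: Γ) b → Prog Γ b
  | intLit {Γ : List Ty} : ℤ → Prog Γ .int
  | intAdd {Γ : List Ty} : Prog Γ .int → Prog Γ .int → Prog Γ .int
  | intSub {Γ : List Ty} : Prog Γ .int → Prog Γ .int → Prog Γ .int
  | toReal {Γ : List Ty} : Prog Γ .int → Prog Γ .real
  | floor {Γ : List Ty} : Prog Γ .real → Prog Γ .int
  | add {Γ : List Ty} : Prog Γ .real → Prog Γ .real → Prog Γ .real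
  | sub {Γ : List Ty} : Prog Γ .real → Prog Γ .real → Prog Γ .real
  | mul {Γ : List Ty} : Prog Γ .real → Prog Γ .real → Prog Γ .real
  | div {Γ : List Ty} : Prog Γ .real → Prog Γ .real → Prog Γ .real
  | exp {Γ : List Ty} : Prog Γ .real → Prog Γ .real
  | ifIntLe {Γ : List Ty} {a : Ty} :
      Prog Γ .int → Prog Γ .int → Prog Γ a → Prog Γ a → Prog Γ a
  | ifLe {Γ : List Ty} {a : Ty} :
      Prog Γ .real → Prog Γ .real → Prog Γ a → Prog Γ a → Prog Γ a
  | pair {Γ : List Ty} {a b : Ty} : Prog Γ a → Prog Γ b → Prog Γ (.prod a b)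
  | fst {Γ : List Ty} {a b : Ty} : Prog Γ (.prod a b) → Prog Γ a
  | snd {Γ : List Ty} {a b : Ty} : Prog Γ (.prod a b) → Prog Γ b
  | nil {Γ : List Ty} {a : Ty} : Prog Γ (.list a)
  | cons {Γ : List Ty} {a : Ty} : Prog Γ a → Prog Γ (.list a) → Prog Γ (.list a)
  | caseList {Γ : List Ty} {a b : Ty} :
      Prog Γ (.list a) → Prog Γ b → Prog (a :: .list a :: Γ) b → Prog Γ b
  | fold {Γ : List Ty} {a b : Ty} :
      Prog Γ (.list a) → Prog Γ b → Prog (a :: b :: Γ) b → Prog Γ b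
  | iter {Γ : List Ty} {b : Ty} : Prog Γ .int → Prog Γ b → Prog (b :: Γ) b → Prog Γ b

/-- The result of a program and the number of steps that it takes: one step for each construct
whenever it is executed, and one more for every round of a loop. Only the branch that is taken is
executed. `fold l b₀ s` runs through the list `l` from its head on, updating a value that starts
as `b₀` by the body `s`; `iter n b₀ s` does `n` rounds (none if `n ≤ 0`). -/
noncomputable def Prog.run : {Γ : List Ty} → {a : Ty} → Prog Γ a → Env Γ → a.Val × ℕ
  | _, _, .var v, γ => (v.get γ, 1)
  | _, _, .letIn e t, γ =>
      let r := e.run γ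
      let s := t.run (r.1, γ)
      (s.1, r.2 + s.2 + 1)
  | _, _, .intLit n, _ => (n, 1)
  | _, _, .intAdd s t, γ =>
      let m : ℤ := (s.run γ).1
      let n : ℤ := (t.run γ).1
      (m + n, (s.run γ).2 + (t.run γ).2 + 1)
  | _, _, .intSub s t, γ =>
      let m : ℤ := (s.run γ).1
      let n : ℤ := (t.run γ).1
      (m - n, (s.run γ).2 + (t.run γ).2 + 1)
  | _, _, .toReal t, γ =>
      let n : ℤ := (t.run γ).1
      ((n : ℝ), (t.run γ).2 + 1)
  | _, _, .floor t, γ =>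
      let u : ℝ := (t.run γ).1
      (⌊u⌋, (t.run γ).2 + 1)
  | _, _, .add s t, γ =>
      let u : ℝ := (s.run γ).1
      let v : ℝ := (t.run γ).1
      (u + v, (s.run γ).2 + (t.run γ).2 + 1)
  | _, _, .sub s t, γ =>
      let u : ℝ := (s.run γ).1
      let v : ℝ := (t.run γ).1
      (u - v, (s.run γ).2 + (t.run γ).2 + 1)
  | _, _, .mul s t, γ =>
      let u : ℝ := (s.run γ).1
      let v : ℝ := (t.run γ).1
      (u * v, (s.run γ).2 + (t.run γ).2 + 1)
  | _, _, .div s t, γ =>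
      let u : ℝ := (s.run γ).1
      let v : ℝ := (t.run γ).1
      (u / v, (s.run γ).2 + (t.run γ).2 + 1)
  | _, _, .exp t, γ =>
      let u : ℝ := (t.run γ).1
      (Real.exp u, (t.run γ).2 + 1)
  | _, _, .ifIntLe s t p q, γ =>
      let m : ℤ := (s.run γ).1
      let n : ℤ := (t.run γ).1
      let r := if m ≤ n then p.run γ else q.run γ
      (r.1, (s.run γ).2 + (t.run γ).2 + r.2 + 1)
  | _, _, .ifLe s t p q, γ =>
      let u : ℝ := (s.run γ).1
      let v : ℝ := (t.run γ).1
      let r := open Classical in if u ≤ v then p.run γ else q.run γ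
      (r.1, (s.run γ).2 + (t.run γ).2 + r.2 + 1)
  | _, _, .pair s t, γ => (((s.run γ).1, (t.run γ).1), (s.run γ).2 + (t.run γ).2 + 1)
  | _, _, .fst t, γ => ((t.run γ).1.1, (t.run γ).2 + 1)
  | _, _, .snd t, γ => ((t.run γ).1.2, (t.run γ).2 + 1)
  | _, _, .nil, _ => ([], 1)
  | _, _, .cons s t, γ => (List.cons (s.run γ).1 (t.run γ).1, (s.run γ).2 + (t.run γ).2 + 1)
  | _, _, .caseList (a := a) l p q, γ =>
      let xs : List a.Val := (l.run γ).1
      let r := match xs with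
        | [] => p.run γ
        | x :: xs' => q.run (x, xs', γ)
      (r.1, (l.run γ).2 + r.2 + 1)
  | _, _, .fold (a := a) l init body, γ =>
      let xs : List a.Val := (l.run γ).1
      xs.foldl
        (fun st x =>
          let r := body.run (x, st.1, γ)
          (r.1, st.2 + r.2 + 1))
        ((init.run γ).1, (l.run γ).2 + (init.run γ).2 + 1)
  | _, _, .iter n init body, γ =>
      let k : ℤ := (n.run γ).1
      (fun st =>
        let r := body.run (st.1, γ)
        (r.1, st.2 + r.2 + 1))^[k.toNat]
        ((init.run γ).1, (n.run γ).2 + (init.run γ).2 + 1)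

/-- The inputs of a program that evaluates one of the two functions of the Fast Gauss Transform
pair: the point, the center and the radius of the ball, and the truncation order `ρ`. -/
abbrev fgtInputTy : List Ty := [.list .real, .list .real, .real, .int]

/-- Sparse vectors: lists of entries, each consisting of a cell, a multi-index and a value. -/
abbrev sparseTy : Ty := .list (.prod (.prod (.list .int) (.list .int)) .real)

/-- The input for evaluation at the point `x`. -/
def fgtInput {d : ℕ} (p : EuclideanSpace ℝ (Fin d)) (Φ : ℝ) (ρ : ℕ)
    (x : EuclideanSpace ℝ (Fin d)) : Env fgtInputTy :=
  (List.ofFn (fun j => x j), List.ofFn (fun j => p j), Φ, (ρ : ℤ), ())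

/-- The name of a coordinate in a sparse vector. -/
def FGTIndex.key {d : ℕ} {p : EuclideanSpace ℝ (Fin d)} {Φ : ℝ} {ρ : ℕ} (i : FGTIndex p Φ ρ) :
    List ℤ × List ℤ :=
  (List.ofFn i.1.1, List.ofFn (fun j => ((i.2 j : ℕ) : ℤ)))

/-- The list `L` of named entries is a sparse representation of the vector `v`: no coordinate
occurs twice, all entries are right, and the coordinates that do not occur are zero. -/
def Represents {d : ℕ} {p : EuclideanSpace ℝ (Fin d)} {Φ : ℝ} {ρ : ℕ}
    (L : List ((List ℤ × List ℤ) × ℝ)) (v : FGTIndex p Φ ρ → ℝ) : Prop :=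
  (L.map Prod.fst).Nodup ∧
  (∀ e ∈ L, ∃ i, FGTIndex.key i = e.1 ∧ v i = e.2) ∧
  ∀ i, v i ≠ 0 → ∃ e ∈ L, FGTIndex.key i = e.1

/-- On every input `x ∈ ℝ^d`, the program `F` computes the vector `v x` (in sparse representation)
in at most `T` steps. -/
def EvaluatesInTime {d : ℕ} (F : Prog fgtInputTy sparseTy) (p : EuclideanSpace ℝ (Fin d)) (Φ : ℝ)
    (ρ : ℕ) (v : EuclideanSpace ℝ (Fin d) → FGTIndex p Φ ρ → ℝ) (T : ℝ) : Prop :=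
  ∀ x, Represents (F.run (fgtInput p Φ ρ x)).1 (v x) ∧ ((F.run (fgtInput p Φ ρ x)).2 : ℝ) ≤ T

/-! ### Hermite functions -/

/-! Approximation. The kernel is a product of one-dimensional factors `exp (-(v - u) ^ 2)`, where
`u` and `v` are coordinates of `x` and `y` relative to the center of the cell of `x`, so `|u| ≤ 1 /
2`. The Taylor series in `u` has coefficients `h_r(v) / r!`. The function `exp (-w ^ 2)` is entire
and bounded by `e` on unit circles with real center, so Cauchy's estimate bounds these coefficients
by `e`, uniformly in `r` and `v`. Truncation after order `ρ` therefore costs at most `e * 2 ^ (-ρ)`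
per factor, and at most `(1 + e * 2 ^ (-ρ)) ^ d - 1` for the product. Expanding the product of
truncated series gives exactly the inner product of `f x` and `g y`, as only the cell of `x`
contributes. If `g` is cut off at this cell, then `y` is far from `x` and the kernel itself is at
most `exp (-(ρ / 2 - d / 4))`. Both errors are at most `α` when `ρ` is a suitable multiple of `log
(1 / α)`, because `d` is at most `c * log (1 / α)`.

Size. The cells that meet the ball are disjoint, have volume one and lie in a ball of radius `Φ +
√d`; the volume formula and `rpow_le_Gamma_add_one` bound their number (`card_ballCells_le`). The
vector `f x` lives on one cell, and `g y` on cells whose coordinates lie in windows of `2 * ρ + 3`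
integers.

Time. For each coordinate the programs list all candidate cell coordinates and indices, with factors
found by a recurrence. They form the product of these lists and finally discard the entries whose
cell is too far from the point or misses the ball. The latter is decided exactly by
`mem_ballCells_iff`, so the ball's cells are never enumerated and the time does not depend on `Φ`.
The lists have at most `((2 * ρ + 3) * (ρ + 1)) ^ d` entries, which dominates the running time. -/

theorem ofReal_iteratedDeriv_exp_neg_sq (r : ℕ) (t : ℝ) :
    ((iteratedDeriv r (fun s : ℝ => Real.exp (-s ^ 2)) t : ℝ) : ℂ) =
      iteratedDeriv r (fun w : ℂ => Complex.exp (-w ^ 2)) t := by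
  induction r generalizing t with
  | zero => simp
  | succ n ih =>
    have hC : ContDiff ℂ ⊤ (fun w : ℂ => Complex.exp (-w ^ 2)) := by fun_prop
    have hR : ContDiff ℝ ⊤ (fun s : ℝ => Real.exp (-s ^ 2)) := by fun_prop
    have dC := (hC.differentiable_iteratedDeriv n (WithTop.coe_lt_top _)) (t : ℂ)
    have dR := (hR.differentiable_iteratedDeriv n (WithTop.coe_lt_top _)) t
    have h1 := dC.hasDerivAt.comp_ofReal
    have h2 := dR.hasDerivAt.ofReal_comp
    simp only [ih] at h2
    rw [iteratedDeriv_succ, iteratedDeriv_succ]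
    exact h2.unique h1

/-- Cauchy's estimate on the unit circle around the real point `t`: there `|Im w| ≤ 1`, so `|exp (-w
^ 2)| = exp (Im w ^ 2 - Re w ^ 2) ≤ e`. -/
theorem abs_hermiteFun_div_factorial_le (r : ℕ) (t : ℝ) :
    |1 / (r.factorial : ℝ) * hermiteFun r t| ≤ Real.exp 1 := by
  have hC : Differentiable ℂ (fun w : ℂ => Complex.exp (-w ^ 2)) := by fun_prop
  have h := Complex.norm_iteratedDeriv_le_of_forall_mem_sphere_norm_le (c := (t : ℂ)) (R := 1)
    (C := Real.exp 1) r one_pos hC.diffContOnCl (by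
      intro w hw
      rw [Complex.norm_exp]
      apply Real.exp_le_exp.2
      have h1 : ‖w - t‖ = 1 := by simpa [dist_eq_norm] using hw
      have h2 := Complex.abs_im_le_norm (w - t)
      rw [h1] at h2
      have h3 : w.im ^ 2 ≤ 1 := by
        have : |w.im| ≤ 1 := by simpa using h2
        exact (sq_le_one_iff_abs_le_one _).2 this
      have h4 : (-w ^ 2).re = w.im ^ 2 - w.re ^ 2 := by
        simp [pow_two]
      rw [h4]
      nlinarith [sq_nonneg w.re])
  rw [← ofReal_iteratedDeriv_exp_neg_sq, Complex.norm_real, Real.norm_eq_abs] at h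
  have hr : (0 : ℝ) < r.factorial := by positivity
  rw [hermiteFun, abs_mul, abs_mul, abs_pow, abs_neg, abs_one, one_pow, one_mul,
    abs_of_pos (by positivity), one_div, inv_mul_le_iff₀ hr]
  simpa using h

/-- Taylor series of the entire function `exp (-w ^ 2)` at `v`, evaluated at `v - u`. The sign `(-1)
^ r` in the Hermite function absorbs that of `(-u) ^ r`. -/
theorem hasSum_hermiteFun (u v : ℝ) :
    HasSum (fun r : ℕ => u ^ r * (1 / (r.factorial : ℝ) * hermiteFun r v))
      (Real.exp (-(v - u) ^ 2)) := by
  have hC : Differentiable ℂ (fun w : ℂ => Complex.exp (-w ^ 2)) := by fun_prop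
  have h := Complex.hasSum_taylorSeries_of_entire hC (v : ℂ) ((v - u : ℝ) : ℂ)
  rw [← Complex.hasSum_ofReal]
  have e : (fun r : ℕ => ((u ^ r * (1 / (r.factorial : ℝ) * hermiteFun r v) : ℝ) : ℂ)) =
      fun r => ((r.factorial : ℂ))⁻¹ • (((v - u : ℝ) : ℂ) - v) ^ r •
        iteratedDeriv r (fun w : ℂ => Complex.exp (-w ^ 2)) v := by
    funext r
    rw [← ofReal_iteratedDeriv_exp_neg_sq, hermiteFun]
    have : ((v - u : ℝ) : ℂ) - v = -u := by push_cast; ring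
    rw [this, neg_pow]
    push_cast
    simp only [smul_eq_mul]
    ring
  rw [e]
  exact_mod_cast h

theorem abs_exp_sub_sum_hermiteFun_le (ρ : ℕ) (u v : ℝ) (hu : |u| ≤ 1 / 2) :
    |Real.exp (-(v - u) ^ 2) -
      ∑ r ∈ Finset.range (ρ + 1), u ^ r * (1 / (r.factorial : ℝ) * hermiteFun r v)| ≤
      Real.exp 1 * (1 / 2) ^ ρ := by
  have h := (hasSum_nat_add_iff' (ρ + 1)).2 (hasSum_hermiteFun u v)
  rw [← h.tsum_eq, ← Real.norm_eq_abs]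
  -- The tail is dominated by a geometric series, since `|u| ≤ 1 / 2` and the coefficients are at
  -- most `e`.
  have hg : HasSum (fun n : ℕ => Real.exp 1 * (1 / 2) ^ (ρ + 1) * (1 / 2 : ℝ) ^ n)
      (Real.exp 1 * (1 / 2) ^ (ρ + 1) * 2) := hasSum_geometric_two.mul_left _
  have := tsum_of_norm_bounded (f := fun n : ℕ => u ^ (n + (ρ + 1)) *
      (1 / ((n + (ρ + 1)).factorial : ℝ) * hermiteFun (n + (ρ + 1)) v)) hg (by
    intro n
    rw [norm_mul, norm_pow, Real.norm_eq_abs, Real.norm_eq_abs]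
    calc _ ≤ (1 / 2 : ℝ) ^ (n + (ρ + 1)) * Real.exp 1 :=
          mul_le_mul (pow_le_pow_left₀ (abs_nonneg _) hu _)
            (abs_hermiteFun_div_factorial_le _ _) (abs_nonneg _) (by positivity)
      _ = _ := by rw [pow_add]; ring)
  calc _ ≤ _ := this
    _ = _ := by rw [pow_succ]; ring

/-! ### Three-term recurrence of the Hermite functions -/

theorem hermiteFun_zero (t : ℝ) : hermiteFun 0 t = Real.exp (-t ^ 2) := by simp [hermiteFun]

theorem iteratedDeriv_one_exp_neg_sq :
    iteratedDeriv 1 (fun s : ℝ => Real.exp (-s ^ 2)) =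
      fun t => -2 * t * Real.exp (-t ^ 2) := by
  funext t
  rw [iteratedDeriv_one]
  have h : HasDerivAt (fun s : ℝ => Real.exp (-s ^ 2)) _ t := ((hasDerivAt_pow 2 t).neg).exp
  rw [h.deriv]
  simp
  ring

theorem iteratedDeriv_exp_neg_sq_add_two (n : ℕ) :
    iteratedDeriv (n + 2) (fun s : ℝ => Real.exp (-s ^ 2)) = fun t =>
      -2 * t * iteratedDeriv (n + 1) (fun s : ℝ => Real.exp (-s ^ 2)) t -
        2 * (n + 1) * iteratedDeriv n (fun s : ℝ => Real.exp (-s ^ 2)) t := by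
  have hR : ContDiff ℝ ⊤ (fun s : ℝ => Real.exp (-s ^ 2)) := by fun_prop
  have key : ∀ m (t : ℝ), HasDerivAt (iteratedDeriv m (fun s : ℝ => Real.exp (-s ^ 2)))
      (iteratedDeriv (m + 1) (fun s : ℝ => Real.exp (-s ^ 2)) t) t := by
    intro m t
    rw [iteratedDeriv_succ]
    exact ((hR.differentiable_iteratedDeriv m (WithTop.coe_lt_top _)) t).hasDerivAt
  have lin : ∀ t : ℝ, HasDerivAt (fun t : ℝ => -2 * t) (-2) t := fun t => by
    simpa using (hasDerivAt_id t).const_mul (-2 : ℝ)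
  induction n with
  | zero =>
    funext t
    rw [iteratedDeriv_succ, iteratedDeriv_one_exp_neg_sq]
    have h := (lin t).mul (key 0 t)
    simp only [iteratedDeriv_zero] at h
    refine h.deriv.trans ?_
    rw [iteratedDeriv_one_exp_neg_sq]
    simp
    ring
  | succ n ih =>
    funext t
    rw [iteratedDeriv_succ, ih]
    refine (((lin t).mul (key (n + 1) t)).sub ((key n t).const_mul (2 * ((n : ℝ) + 1)))).deriv.trans ?_
    rw [congrFun ih t]
    push_cast
    ring

theorem hermiteFun_one (t : ℝ) : hermiteFun 1 t = 2 * t * hermiteFun 0 t := by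
  rw [hermiteFun, iteratedDeriv_one_exp_neg_sq, hermiteFun_zero]
  ring

theorem hermiteFun_add_two (n : ℕ) (t : ℝ) :
    hermiteFun (n + 2) t = 2 * t * hermiteFun (n + 1) t - 2 * (n + 1) * hermiteFun n t := by
  simp only [hermiteFun, iteratedDeriv_exp_neg_sq_add_two]
  ring

/-! ### Approximation of the kernel -/

/-- Replacing one factor at a time: the exact factors `E i` are at most `1` in absolute value, hence
the approximate ones `A i` at most `1 + ε`. -/
theorem abs_prod_sub_prod_le {ι : Type*} (s : Finset ι) (A E : ι → ℝ) {ε : ℝ} (hε : 0 ≤ ε)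
    (hE : ∀ i ∈ s, |E i| ≤ 1) (hA : ∀ i ∈ s, |E i - A i| ≤ ε) :
    |∏ i ∈ s, E i - ∏ i ∈ s, A i| ≤ (1 + ε) ^ s.card - 1 := by
  classical
  induction s using Finset.induction_on with
  | empty => simp
  | insert a s ha ih =>
    rw [Finset.prod_insert ha, Finset.prod_insert ha, Finset.card_insert_of_notMem ha]
    have ih' := ih (fun i hi => hE i (Finset.mem_insert_of_mem hi))
      (fun i hi => hA i (Finset.mem_insert_of_mem hi))
    have h1 := hE a (Finset.mem_insert_self _ _)
    have h2 := hA a (Finset.mem_insert_self _ _)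
    have h3 : |∏ i ∈ s, E i| ≤ 1 := by
      rw [Finset.abs_prod]
      exact Finset.prod_le_one (fun i _ => abs_nonneg _)
        (fun i hi => hE i (Finset.mem_insert_of_mem hi))
    have h4 : |A a| ≤ 1 + ε := by
      have := abs_sub_abs_le_abs_sub (A a) (E a)
      rw [abs_sub_comm] at this
      linarith
    have : E a * ∏ i ∈ s, E i - A a * ∏ i ∈ s, A i =
        (E a - A a) * ∏ i ∈ s, E i + A a * (∏ i ∈ s, E i - ∏ i ∈ s, A i) := by ring
    rw [this]
    calc _ ≤ |(E a - A a) * ∏ i ∈ s, E i| + |A a * (∏ i ∈ s, E i - ∏ i ∈ s, A i)| := abs_add_le _ _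
      _ ≤ ε * 1 + (1 + ε) * ((1 + ε) ^ s.card - 1) := by
        rw [abs_mul, abs_mul]
        gcongr
      _ = _ := by ring

theorem gaussianKernel_eq_prod {d : ℕ} (x y : EuclideanSpace ℝ (Fin d)) :
    gaussianKernel x y = ∏ j, Real.exp (-(x j - y j) ^ 2) := by
  rw [gaussianKernel, EuclideanSpace.norm_sq_eq, ← Real.exp_sum, Finset.sum_neg_distrib]
  simp

theorem abs_sub_cellCenter_le {d : ℕ} {m : Fin d → ℤ} {x : EuclideanSpace ℝ (Fin d)}
    (hx : x ∈ gridCell m) (j : Fin d) : |x j - cellCenter m j| ≤ 1 / 2 := by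
  have := hx j
  simp only [cellCenter]
  rw [abs_le]
  constructor <;> linarith [this.1, this.2]

theorem abs_fgtF_le_one {d : ℕ} (p : EuclideanSpace ℝ (Fin d)) (Φ : ℝ) (ρ : ℕ)
    (x : EuclideanSpace ℝ (Fin d)) (i : FGTIndex p Φ ρ) : |fgtF p Φ ρ x i| ≤ 1 := by
  unfold fgtF
  split_ifs with h
  · rw [Finset.abs_prod]
    refine Finset.prod_le_one (fun i _ => abs_nonneg _) (fun j _ => ?_)
    rw [abs_pow]
    exact pow_le_one₀ (abs_nonneg _) ((abs_sub_cellCenter_le h j).trans (by norm_num))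
  · simp

theorem abs_fgtG_le {d : ℕ} (p : EuclideanSpace ℝ (Fin d)) (Φ : ℝ) (ρ : ℕ)
    (y : EuclideanSpace ℝ (Fin d)) (i : FGTIndex p Φ ρ) : |fgtG p Φ ρ y i| ≤ Real.exp 1 ^ d := by
  unfold fgtG
  split_ifs with h
  · rw [Finset.abs_prod]
    calc _ ≤ ∏ _j : Fin d, Real.exp 1 :=
          Finset.prod_le_prod (fun i _ => abs_nonneg _)
            (fun j _ => abs_hermiteFun_div_factorial_le _ _)
      _ = _ := by simp
  · simp only [abs_zero]; positivity

/-- The cell that contains a point. -/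
noncomputable def cellOf {d : ℕ} (x : EuclideanSpace ℝ (Fin d)) : Fin d → ℤ := fun j => ⌊x j⌋

theorem mem_gridCell_iff {d : ℕ} (m : Fin d → ℤ) (x : EuclideanSpace ℝ (Fin d)) :
    x ∈ gridCell m ↔ m = cellOf x := by
  constructor
  · intro h
    funext j
    exact (Int.floor_eq_iff.2 (h j)).symm
  · rintro rfl j
    exact ⟨Int.floor_le _, Int.lt_floor_add_one _⟩

theorem fgtF_dotProduct_fgtG {d : ℕ} (p : EuclideanSpace ℝ (Fin d)) (Φ : ℝ) (ρ : ℕ)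
    (x y : EuclideanSpace ℝ (Fin d)) (hx : x ∈ Metric.closedBall p Φ) :
    fgtF p Φ ρ x ⬝ᵥ fgtG p Φ ρ y =
      if ‖y - cellCenter (cellOf x)‖ ^ 2 ≤ ρ then
        ∏ j, ∑ r ∈ Finset.range (ρ + 1), (x j - cellCenter (cellOf x) j) ^ r *
          (1 / (r.factorial : ℝ) * hermiteFun r (y j - cellCenter (cellOf x) j))
      else 0 := by
  classical
  have hc : x ∈ gridCell (cellOf x) := (mem_gridCell_iff _ _).2 rfl
  have hm : cellOf x ∈ ballCells p Φ := ⟨x, hc, hx⟩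
  rw [dotProduct, Fintype.sum_prod_type, Finset.sum_eq_single (⟨cellOf x, hm⟩ : ballCells p Φ)]
  · simp only [fgtF, fgtG, hc, if_true]
    split_ifs with h
    · simp only [← Finset.prod_mul_distrib, Finset.sum_range]
      -- Distributivity turns the product of truncated series into the sum over all multi-indices.
      rw [Finset.prod_univ_sum, Fintype.piFinset_univ]
    · simp
  · intro b _ hb
    refine Finset.sum_eq_zero fun r _ => ?_
    have : x ∉ gridCell b.1 := fun h => hb (Subtype.ext ((mem_gridCell_iff _ _).1 h))
    simp [fgtF, this]
  · simp

theorem abs_gaussianKernel_sub_dotProduct_le {d : ℕ} (p : EuclideanSpace ℝ (Fin d)) (Φ : ℝ) (ρ : ℕ)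
    (x y : EuclideanSpace ℝ (Fin d)) (hx : x ∈ Metric.closedBall p Φ) {α : ℝ}
    (hfar : Real.exp (-((ρ : ℝ) / 2 - d / 4)) ≤ α)
    (hnear : (1 + Real.exp 1 * (1 / 2) ^ ρ) ^ d - 1 ≤ α) :
    |gaussianKernel x y - fgtF p Φ ρ x ⬝ᵥ fgtG p Φ ρ y| ≤ α := by
  have hc : x ∈ gridCell (cellOf x) := (mem_gridCell_iff _ _).2 rfl
  rw [fgtF_dotProduct_fgtG p Φ ρ x y hx]
  set z := cellCenter (cellOf x)
  split_ifs with h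
  · refine le_trans ?_ hnear
    rw [gaussianKernel_eq_prod]
    have := abs_prod_sub_prod_le Finset.univ
      (fun j => ∑ r ∈ Finset.range (ρ + 1), (x j - z j) ^ r *
          (1 / (r.factorial : ℝ) * hermiteFun r (y j - z j)))
      (fun j => Real.exp (-(x j - y j) ^ 2)) (ε := Real.exp 1 * (1 / 2) ^ ρ) (by positivity)
      (fun j _ => by
        rw [abs_of_pos (Real.exp_pos _), Real.exp_le_one_iff]
        nlinarith [sq_nonneg (x j - y j)])
      (fun j _ => by
        have := abs_exp_sub_sum_hermiteFun_le ρ (x j - z j) (y j - z j)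
          (abs_sub_cellCenter_le hc j)
        rwa [show -(y j - z j - (x j - z j)) ^ 2 = -(x j - y j) ^ 2 by ring] at this)
    simpa using this
  · refine le_trans ?_ hfar
    rw [sub_zero, gaussianKernel, abs_of_pos (Real.exp_pos _)]
    apply Real.exp_le_exp.2
    have h1 : ‖x - z‖ ^ 2 ≤ d / 4 := by
      rw [EuclideanSpace.norm_sq_eq]
      calc _ ≤ ∑ _j : Fin d, (1 / 4 : ℝ) := by
            refine Finset.sum_le_sum fun j _ => ?_
            have := abs_sub_cellCenter_le hc j
            rw [Real.norm_eq_abs, show (1 / 4 : ℝ) = (1 / 2) ^ 2 by norm_num]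
            exact pow_le_pow_left₀ (abs_nonneg _) this 2
        _ = _ := by simp; ring
    have h2 : ‖y - z‖ ≤ ‖x - y‖ + ‖x - z‖ := by
      have := norm_sub_le (x - z) (x - y)
      rw [show x - z - (x - y) = y - z by abel] at this
      linarith
    have h3 : ‖y - z‖ ^ 2 ≤ (‖x - y‖ + ‖x - z‖) ^ 2 := pow_le_pow_left₀ (norm_nonneg _) h2 2
    -- By `(a + b) ^ 2 ≤ 2 * a ^ 2 + 2 * b ^ 2`, the cutoff `ρ < ‖y - z‖ ^ 2` gives `‖x - y‖ ^ 2 ≥ ρ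
    -- / 2 - d / 4`.
    nlinarith [sq_nonneg (‖x - y‖ - ‖x - z‖)]

/-! ### Counting cells -/

/-- A weak Stirling bound: restrict the Gamma integral to `x > s`, where `x ^ s ≥ s ^ s`. It makes
the volume of a ball of radius `r` at most `(const * r / √d) ^ d`. -/
theorem rpow_le_Gamma_add_one {s : ℝ} (hs : 0 < s) : (s / Real.exp 1) ^ s ≤ Real.Gamma (s + 1) := by
  rw [Real.Gamma_eq_integral (by linarith)]
  have hint := Real.GammaIntegral_convergent (s := s + 1) (by linarith)
  calc (s / Real.exp 1) ^ s = ∫ x in Set.Ioi s, Real.exp (-x) * s ^ s := by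
        rw [integral_mul_const, integral_exp_neg_Ioi, Real.div_rpow hs.le (Real.exp_pos _).le,
          ← Real.exp_mul, one_mul, Real.exp_neg]
        ring
    _ ≤ ∫ x in Set.Ioi s, Real.exp (-x) * x ^ (s + 1 - 1) := by
        refine setIntegral_mono_on ?_ (hint.mono_set (Set.Ioi_subset_Ioi hs.le)) measurableSet_Ioi ?_
        · exact (integrableOn_exp_neg_Ioi s).mul_const _
        · intro x hx
          rw [add_sub_cancel_right]
          have : s ≤ x := le_of_lt hx
          gcongr
    _ ≤ _ := by
        refine setIntegral_mono_set hint ?_ (Set.Ioi_subset_Ioi hs.le).eventuallyLE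
        filter_upwards [ae_restrict_mem measurableSet_Ioi] with x hx
        have : (0 : ℝ) < x := hx
        simp only [Pi.zero_apply]
        positivity

theorem gridCell_eq_preimage {d : ℕ} (m : Fin d → ℤ) :
    gridCell m = WithLp.ofLp ⁻¹' (Set.univ.pi fun j => Set.Ico (m j : ℝ) (m j + 1)) := by
  ext x
  simp [gridCell]

theorem measurableSet_gridCell {d : ℕ} (m : Fin d → ℤ) : MeasurableSet (gridCell m) := by
  rw [gridCell_eq_preimage]
  exact (PiLp.volume_preserving_ofLp (Fin d)).measurable
    (MeasurableSet.univ_pi fun j => measurableSet_Ico)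

theorem volume_gridCell {d : ℕ} (m : Fin d → ℤ) : volume (gridCell m) = 1 := by
  rw [gridCell_eq_preimage, (PiLp.volume_preserving_ofLp (Fin d)).measure_preimage
    (MeasurableSet.univ_pi fun j => measurableSet_Ico).nullMeasurableSet, Real.volume_pi_Ico]
  simp

theorem disjoint_gridCell {d : ℕ} {m n : Fin d → ℤ} (h : m ≠ n) :
    Disjoint (gridCell m) (gridCell n) :=
  Set.disjoint_left.2 fun x hm hn =>
    h (((mem_gridCell_iff m x).1 hm).trans ((mem_gridCell_iff n x).1 hn).symm)

theorem dist_le_of_mem_gridCell {d : ℕ} {m : Fin d → ℤ} {x y : EuclideanSpace ℝ (Fin d)}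
    (hx : x ∈ gridCell m) (hy : y ∈ gridCell m) : dist x y ≤ Real.sqrt d := by
  rw [EuclideanSpace.dist_eq]
  apply Real.sqrt_le_sqrt
  calc _ ≤ ∑ _j : Fin d, (1 : ℝ) := by
        refine Finset.sum_le_sum fun j _ => ?_
        rw [Real.dist_eq, sq_abs, sq_le_one_iff_abs_le_one, abs_le]
        have h1 := hx j
        have h2 := hy j
        constructor <;> linarith [h1.1, h1.2, h2.1, h2.2]
    _ = d := by simp

theorem card_ballCells_le {d : ℕ} (hd : 1 ≤ d) (p : EuclideanSpace ℝ (Fin d)) {Φ : ℝ} (hΦ : 0 < Φ) :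
    (Fintype.card (ballCells p Φ) : ℝ) ≤ (5 * (1 + Φ / Real.sqrt d)) ^ d := by
  have hd0 : (0 : ℝ) < d := by exact_mod_cast hd
  have : Nonempty (Fin d) := ⟨⟨0, hd⟩⟩
  have hsub : (⋃ m : ballCells p Φ, gridCell m.1) ⊆ Metric.closedBall p (Φ + Real.sqrt d) := by
    refine Set.iUnion_subset ?_
    rintro ⟨m, x, hx, hxp⟩ y hy
    have h1 := dist_le_of_mem_gridCell hy hx
    have h2 : dist x p ≤ Φ := hxp
    have h3 := dist_triangle y x p
    simp only [Metric.mem_closedBall]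
    linarith
  have hvol := measure_mono (μ := volume) hsub
  rw [measure_iUnion (fun m n h => disjoint_gridCell (fun e => h (Subtype.ext e)))
    (fun m => measurableSet_gridCell m.1), tsum_fintype, EuclideanSpace.volume_closedBall] at hvol
  simp only [volume_gridCell, Finset.sum_const, Finset.card_univ, nsmul_eq_mul, mul_one,
    Fintype.card_fin] at hvol
  have hr : 0 < Φ + Real.sqrt d := by positivity
  have hG : 0 < Real.Gamma ((d : ℝ) / 2 + 1) := Real.Gamma_pos_of_pos (by positivity)
  rw [← ENNReal.ofReal_pow hr.le, ← ENNReal.ofReal_mul (by positivity),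
    ← ENNReal.ofReal_natCast, ENNReal.ofReal_le_ofReal_iff (by positivity)] at hvol
  refine hvol.trans ?_
  have hg : Real.sqrt (d / 2 / Real.exp 1) ^ d ≤ Real.Gamma ((d : ℝ) / 2 + 1) := by
    refine le_of_eq_of_le ?_ (rpow_le_Gamma_add_one (s := (d : ℝ) / 2) (by positivity))
    rw [Real.sqrt_eq_rpow, ← Real.rpow_natCast, ← Real.rpow_mul (by positivity)]
    congr 1
    ring
  have hs : 0 < Real.sqrt (d / 2 / Real.exp 1) := Real.sqrt_pos.2 (by positivity)
  calc (Φ + Real.sqrt d) ^ d * (Real.sqrt Real.pi ^ d / Real.Gamma ((d : ℝ) / 2 + 1))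
      ≤ (Φ + Real.sqrt d) ^ d * (Real.sqrt Real.pi ^ d / Real.sqrt (d / 2 / Real.exp 1) ^ d) := by
        gcongr
    _ = ((Φ + Real.sqrt d) * (Real.sqrt Real.pi / Real.sqrt (d / 2 / Real.exp 1))) ^ d := by
        rw [mul_pow, div_pow]
    _ ≤ _ := by
        apply pow_le_pow_left₀ (by positivity)
        -- The constant `5` is a rounding of `√(2πe)`, which is about `4.13`.
        have h1 : Real.sqrt Real.pi ≤ 5 / Real.sqrt d * Real.sqrt (d / 2 / Real.exp 1) := by
          rw [show (5 : ℝ) = Real.sqrt (5 ^ 2) by simp, ← Real.sqrt_div (by norm_num),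
            ← Real.sqrt_mul (by positivity)]
          apply Real.sqrt_le_sqrt
          rw [show (5 : ℝ) ^ 2 / d * (d / 2 / Real.exp 1) = 25 / 2 / Real.exp 1 by
            field_simp; norm_num, le_div_iff₀ (Real.exp_pos _)]
          have h2 := Real.exp_one_lt_d9
          have h3 := Real.pi_lt_d2
          nlinarith [Real.pi_pos]
        rw [← div_le_iff₀ hs] at h1
        calc _ ≤ (Φ + Real.sqrt d) * (5 / Real.sqrt d) := by gcongr
          _ = _ := by field_simp; ring

/-! ### Sparsity of the two vectors -/

theorem floor_sub_le_of_norm_sq_le {d : ℕ} {ρ : ℕ} {y : EuclideanSpace ℝ (Fin d)} {m : Fin d → ℤ}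
    (h : ‖y - cellCenter m‖ ^ 2 ≤ ρ) (j : Fin d) :
    ⌊y j⌋ - (ρ + 1) ≤ m j ∧ m j ≤ ⌊y j⌋ + (ρ + 1) := by
  have h1 : (y j - (m j + 1 / 2)) ^ 2 ≤ (ρ : ℝ) := by
    refine le_trans ?_ h
    rw [EuclideanSpace.norm_sq_eq]
    have := Finset.single_le_sum (f := fun j => ‖(y - cellCenter m) j‖ ^ 2)
      (fun i _ => by positivity) (Finset.mem_univ j)
    simpa [cellCenter] using this
  -- The window is cruder than `√ρ`, which avoids square roots: `ρ ≤ (ρ + 1 / 2) ^ 2`.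
  have h2 : |y j - (m j + 1 / 2)| ≤ (ρ : ℝ) + 1 / 2 := by
    apply abs_le_of_sq_le_sq _ (by positivity)
    nlinarith
  rw [abs_le] at h2
  have h3 := Int.floor_le (y j)
  have h4 := Int.lt_floor_add_one (y j)
  constructor
  · have : ((⌊y j⌋ - (ρ + 1) : ℤ) : ℝ) < ((m j + 1 : ℤ) : ℝ) := by push_cast; linarith [h2.1, h2.2]
    have := Int.cast_lt.1 this
    omega
  · have : ((m j : ℤ) : ℝ) < ((⌊y j⌋ + (ρ + 1) + 1 : ℤ) : ℝ) := by push_cast; linarith [h2.1, h2.2]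
    have := Int.cast_lt.1 this
    omega

theorem encard_fgtF_ne_zero_le {d : ℕ} (p : EuclideanSpace ℝ (Fin d)) (Φ : ℝ) (ρ : ℕ)
    (x : EuclideanSpace ℝ (Fin d)) :
    {i | fgtF p Φ ρ x i ≠ 0}.encard ≤ (((2 * ρ + 3) * (ρ + 1)) ^ d : ℕ) := by
  have h : {i | fgtF p Φ ρ x i ≠ 0}.encard ≤
      (Set.univ : Set (Fin d → Fin (ρ + 1))).encard := by
    refine Set.encard_le_encard_of_injOn (f := Prod.snd) (fun _ _ => Set.mem_univ _) ?_
    have key : ∀ i : FGTIndex p Φ ρ, fgtF p Φ ρ x i ≠ 0 → i.1.1 = cellOf x := by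
      intro i hi
      by_contra hne
      exact hi (by simp [fgtF, mem_gridCell_iff, hne])
    intro i hi i' hi' hii
    exact Prod.ext (Subtype.ext ((key i hi).trans (key i' hi').symm)) hii
  refine h.trans ?_
  rw [Set.encard_univ, ENat.card_eq_coe_fintype_card]
  simp only [Fintype.card_pi, Fintype.card_fin, Finset.prod_const, Finset.card_univ]
  exact_mod_cast Nat.pow_le_pow_left (Nat.le_mul_of_pos_left _ (by omega)) d

theorem encard_fgtG_ne_zero_le {d : ℕ} (p : EuclideanSpace ℝ (Fin d)) (Φ : ℝ) (ρ : ℕ)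
    (y : EuclideanSpace ℝ (Fin d)) :
    {i | fgtG p Φ ρ y i ≠ 0}.encard ≤ (((2 * ρ + 3) * (ρ + 1)) ^ d : ℕ) := by
  classical
  set t : Finset (Fin d → ℤ) :=
    Fintype.piFinset fun j => Finset.Icc (⌊y j⌋ - (ρ + 1)) (⌊y j⌋ + (ρ + 1)) with ht
  set u : Finset ((Fin d → ℤ) × (Fin d → Fin (ρ + 1))) := t ×ˢ Finset.univ with hu
  have h : {i | fgtG p Φ ρ y i ≠ 0}.encard ≤ (u : Set ((Fin d → ℤ) × (Fin d → Fin (ρ + 1)))).encard := by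
    refine Set.encard_le_encard_of_injOn (f := fun i => (i.1.1, i.2)) ?_ ?_
    · intro i hi
      have : ‖y - cellCenter i.1.1‖ ^ 2 ≤ ρ := by
        by_contra hne
        exact hi (by simp [fgtG, hne])
      have := floor_sub_le_of_norm_sq_le this
      simp only [hu, ht, Finset.coe_product, Set.mem_prod, Finset.mem_coe, Fintype.mem_piFinset,
        Finset.mem_Icc, Finset.mem_univ, and_true]
      exact this
    · intro i _ i' _ hii
      simp only [Prod.mk.injEq] at hii
      exact Prod.ext (Subtype.ext hii.1) hii.2
  refine h.trans (le_of_eq ?_)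
  rw [Set.encard_coe_eq_coe_finsetCard, hu, Finset.card_product, ht, Fintype.card_piFinset]
  have : ∀ a : ℤ, (a + (ρ + 1) + 1 - (a - (ρ + 1))).toNat = 2 * ρ + 3 := fun a => by omega
  simp [Int.card_Icc, this, mul_pow]

/-! ### A criterion for cells that intersect a ball -/

/-- The squared distance from `p` to the closed interval `[m, m + 1]`. -/
noncomputable def intervalDistSq (m : ℤ) (p : ℝ) : ℝ :=
  if (m : ℝ) + 1 ≤ p then (p - (m + 1)) ^ 2 else if (m : ℝ) ≤ p then 0 else (p - m) ^ 2

open Classical in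
/-- Equals `1` if the distance from `p` to `[m, m + 1)` is not attained, and `0` otherwise. -/
noncomputable def intervalFlag (m : ℤ) (p : ℝ) : ℤ := if (m : ℝ) + 1 ≤ p then 1 else 0

theorem intervalDistSq_le {m : ℤ} {x : ℝ} (h : (m : ℝ) ≤ x ∧ x < m + 1) (p : ℝ) :
    intervalDistSq m p ≤ (x - p) ^ 2 := by
  unfold intervalDistSq
  split_ifs <;> nlinarith [h.1, h.2, sq_nonneg (x - p)]

theorem intervalDistSq_lt {m : ℤ} {x : ℝ} (h : (m : ℝ) ≤ x ∧ x < m + 1) {p : ℝ}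
    (hp : (m : ℝ) + 1 ≤ p) : intervalDistSq m p < (x - p) ^ 2 := by
  rw [intervalDistSq, if_pos hp]
  nlinarith [h.1, h.2]

theorem sum_intervalFlag_le_zero_iff {d : ℕ} (m : Fin d → ℤ) (p : EuclideanSpace ℝ (Fin d)) :
    ∑ j, intervalFlag (m j) (p j) ≤ 0 ↔ ∀ j, p j < m j + 1 := by
  have h0 : ∀ j, 0 ≤ intervalFlag (m j) (p j) := fun j => by unfold intervalFlag; split_ifs <;> simp
  have h1 := Finset.sum_nonneg (s := Finset.univ) fun j _ => h0 j
  rw [← and_iff_left (a := _ ≤ _) h1, ← le_antisymm_iff,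
    Finset.sum_eq_zero_iff_of_nonneg fun j _ => h0 j]
  simp [intervalFlag]

/-- The sum of the `intervalDistSq` is the infimum over the half-open cell of the squared distance
to `p`. It is attained exactly when no coordinate of `p` lies at or beyond the open end, that is,
when all flags vanish. Otherwise the cell meets the closed ball only if the infimum is strictly
below `Φ ^ 2`. -/
theorem mem_ballCells_iff {d : ℕ} (m : Fin d → ℤ) (p : EuclideanSpace ℝ (Fin d)) {Φ : ℝ}
    (hΦ : 0 < Φ) :
    m ∈ ballCells p Φ ↔
      if ∑ j, intervalFlag (m j) (p j) ≤ 0 then ∑ j, intervalDistSq (m j) (p j) ≤ Φ ^ 2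
      else ¬ Φ ^ 2 ≤ ∑ j, intervalDistSq (m j) (p j) := by
  have hdist : ∀ x : EuclideanSpace ℝ (Fin d),
      x ∈ Metric.closedBall p Φ ↔ ∑ j, (x j - p j) ^ 2 ≤ Φ ^ 2 := by
    intro x
    rw [Metric.mem_closedBall, EuclideanSpace.dist_eq, Real.sqrt_le_left hΦ.le]
    simp [Real.dist_eq]
  constructor
  · rintro ⟨x, hx, hxp⟩
    rw [hdist] at hxp
    split_ifs with h
    · exact (Finset.sum_le_sum fun j _ => intervalDistSq_le (hx j) _).trans hxp
    · rw [sum_intervalFlag_le_zero_iff] at h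
      push Not at h ⊢
      obtain ⟨j, hj⟩ := h
      exact (Finset.sum_lt_sum (fun j _ => intervalDistSq_le (hx j) _)
        ⟨j, Finset.mem_univ _, intervalDistSq_lt (hx j) hj⟩).trans_le hxp
  · intro h
    split_ifs at h with hf
    · rw [sum_intervalFlag_le_zero_iff] at hf
      refine ⟨WithLp.toLp 2 fun j => max (m j : ℝ) (p j), fun j => ⟨le_max_left _ _,
        max_lt (lt_add_one _) (hf j)⟩, ?_⟩
      rw [hdist]
      refine le_of_eq_of_le (Finset.sum_congr rfl fun j _ => ?_) h
      rw [intervalDistSq, if_neg (not_le.2 (hf j))]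
      simp only
      split_ifs with h1
      · rw [max_eq_right h1]; ring
      · rw [max_eq_left (not_le.1 h1).le]; ring
    · push Not at h
      -- The infimum is not attained here, so `p` is projected onto the shrunken intervals `[m j, m
      -- j + 1 - ε]` and `ε` tends to `0` from above.
      have hcont : Filter.Tendsto
          (fun ε : ℝ => ∑ j, (max (m j : ℝ) (min (p j) (m j + 1 - ε)) - p j) ^ 2)
          (nhdsWithin 0 (Set.Ioi 0)) (nhds (∑ j, intervalDistSq (m j) (p j))) := by
        refine tendsto_nhdsWithin_of_tendsto_nhds ?_
        have hc : Continuous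
            (fun ε : ℝ => ∑ j, (max (m j : ℝ) (min (p j) (m j + 1 - ε)) - p j) ^ 2) := by fun_prop
        convert hc.tendsto 0 using 2
        refine Finset.sum_congr rfl fun j _ => ?_
        rw [sub_zero, intervalDistSq]
        split_ifs with h1 h2
        · rw [min_eq_right h1, max_eq_right (by linarith)]; ring
        · rw [min_eq_left (not_le.1 h1).le, max_eq_right h2]; ring
        · rw [min_eq_left (not_le.1 h1).le, max_eq_left (not_le.1 h2).le]; ring
      have hlt := hcont.eventually_lt_const h
      have hpos : ∀ᶠ ε : ℝ in nhdsWithin 0 (Set.Ioi 0), ε ∈ Set.Ioi (0 : ℝ) :=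
        eventually_mem_nhdsWithin
      obtain ⟨ε, hε, hε0⟩ := (hlt.and hpos).exists
      have hε0 : 0 < ε := hε0
      refine ⟨WithLp.toLp 2 fun j => max (m j : ℝ) (min (p j) (m j + 1 - ε)), fun j =>
        ⟨le_max_left _ _, max_lt (lt_add_one _)
          ((min_le_right _ _).trans_lt (by linarith))⟩, ?_⟩
      rw [hdist]
      exact hε.le

/-! ### Running loops -/

theorem Prog.run_pair {Γ : List Ty} {a b : Ty} (s : Prog Γ a) (t : Prog Γ b) (γ : Env Γ) :
    (Prog.pair s t).run γ = (((s.run γ).1, (t.run γ).1), (s.run γ).2 + (t.run γ).2 + 1) := rfl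

theorem Prog.run_snd {Γ : List Ty} {a b : Ty} (t : Prog Γ (.prod a b)) (γ : Env Γ) :
    (Prog.snd t).run γ = ((t.run γ).1.2, (t.run γ).2 + 1) := rfl

theorem Prog.run_letIn {Γ : List Ty} {a b : Ty} (e : Prog Γ a) (t : Prog (a :: Γ) b) (γ : Env Γ) :
    (Prog.letIn e t).run γ =
      ((t.run ((e.run γ).1, γ)).1, (e.run γ).2 + (t.run ((e.run γ).1, γ)).2 + 1) := rfl

theorem foldl_step_count_fst {α β : Type*} (f : β → α → β × ℕ) (xs : List α) (st : β × ℕ) :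
    (xs.foldl (fun st x => ((f st.1 x).1, st.2 + (f st.1 x).2 + 1)) st).1 =
      xs.foldl (fun s x => (f s x).1) st.1 := by
  induction xs generalizing st with
  | nil => rfl
  | cons x xs ih => simp [ih]

/-- The cost of a round may depend on the accumulated value, so the bound `c` is required only along
states that satisfy the invariant. The offset `k` lets the induction start in mid-loop. -/
theorem foldl_step_count_snd_le {α β : Type*} (f : β → α → β × ℕ) (I : ℕ → β → Prop) (c n : ℕ)
    (xs : List α) (k : ℕ) (hk : k + xs.length = n) (st : β × ℕ) (h0 : I k st.1)
    (hstep : ∀ k s, ∀ x ∈ xs, k < n → I k s → I (k + 1) (f s x).1 ∧ (f s x).2 ≤ c) :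
    (xs.foldl (fun st x => ((f st.1 x).1, st.2 + (f st.1 x).2 + 1)) st).2 ≤
      st.2 + xs.length * (c + 1) := by
  induction xs generalizing st k with
  | nil => simp
  | cons x xs ih =>
    rw [List.length_cons] at hk
    obtain ⟨h1, h2⟩ := hstep k st.1 x List.mem_cons_self (by omega) h0
    refine (ih (k + 1) (by omega) ((f st.1 x).1, st.2 + (f st.1 x).2 + 1) h1
      fun k s y hy => hstep k s y (List.mem_cons_of_mem _ hy)).trans ?_
    simp only [List.length_cons]
    nlinarith

theorem iterate_step_count_fst {β : Type*} (f : β → β × ℕ) (k : ℕ) (st : β × ℕ) :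
    ((fun st : β × ℕ => ((f st.1).1, st.2 + (f st.1).2 + 1))^[k] st).1 =
      (fun s => (f s).1)^[k] st.1 := by
  induction k generalizing st with
  | zero => rfl
  | succ k ih => simp [Function.iterate_succ_apply, ih]

theorem iterate_step_count_snd_le {β : Type*} (f : β → β × ℕ) (c : ℕ) (hstep : ∀ s, (f s).2 ≤ c)
    (k : ℕ) (st : β × ℕ) :
    ((fun st : β × ℕ => ((f st.1).1, st.2 + (f st.1).2 + 1))^[k] st).2 ≤ st.2 + k * (c + 1) := by
  induction k generalizing st with
  | zero => simp
  | succ k ih =>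
    rw [Function.iterate_succ_apply]
    refine (ih _).trans ?_
    have := hstep st.1
    simp only
    nlinarith

theorem Prog.run_fold_fst {Γ : List Ty} {a b : Ty} {l : Prog Γ (.list a)} {init : Prog Γ b}
    {body : Prog (a :: b :: Γ) b} {γ : Env Γ} (xs : List a.Val) (i : b.Val)
    (f : b.Val → a.Val → b.Val) (hxs : (l.run γ).1 = xs) (hi : (init.run γ).1 = i)
    (hf : ∀ s x, (body.run (x, s, γ)).1 = f s x) :
    ((Prog.fold l init body).run γ).1 = xs.foldl f i := by
  subst hxs hi
  obtain rfl : f = fun s x => (body.run (x, s, γ)).1 := by funext s x; exact (hf s x).symm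
  rw [Prog.run]
  exact foldl_step_count_fst (fun (s : b.Val) (x : a.Val) => body.run (x, s, γ)) _ _

theorem Prog.run_iter_fst {Γ : List Ty} {b : Ty} {n : Prog Γ .int} {init : Prog Γ b}
    {body : Prog (b :: Γ) b} {γ : Env Γ} (k : ℕ) (i : b.Val) (hk : Int.toNat (n.run γ).1 = k)
    (hi : (init.run γ).1 = i) :
    ((Prog.iter n init body).run γ).1 = (fun s : b.Val => (body.run (s, γ)).1)^[k] i := by
  subst hk hi
  rw [Prog.run]
  exact iterate_step_count_fst (fun s : b.Val => body.run (s, γ)) _ _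

/-- A bound for the running time of `fold`, from an invariant `I k s` for the value `s` after
`k` rounds. -/
theorem Prog.run_fold_snd_le {Γ : List Ty} {a b : Ty} {l : Prog Γ (.list a)} {init : Prog Γ b}
    {body : Prog (a :: b :: Γ) b} {γ : Env Γ} (I : ℕ → b.Val → Prop) (c : ℕ) (xs : List a.Val)
    (hxs : (l.run γ).1 = xs) (h0 : I 0 (init.run γ).1)
    (hstep : ∀ k s, ∀ x ∈ xs, k < xs.length → I k s →
      I (k + 1) (body.run (x, s, γ)).1 ∧ (body.run (x, s, γ)).2 ≤ c) :
    ((Prog.fold l init body).run γ).2 ≤ (l.run γ).2 + (init.run γ).2 + 1 +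
      xs.length * (c + 1) := by
  subst hxs
  rw [Prog.run]
  exact foldl_step_count_snd_le (fun (s : b.Val) (x : a.Val) => body.run (x, s, γ)) I c _ _ 0
    (Nat.zero_add _) _ h0 hstep

theorem Prog.run_iter_snd_le {Γ : List Ty} {b : Ty} {n : Prog Γ .int} {init : Prog Γ b}
    {body : Prog (b :: Γ) b} {γ : Env Γ} (k c : ℕ) (hk : Int.toNat (n.run γ).1 = k)
    (hstep : ∀ s, (body.run (s, γ)).2 ≤ c) :
    ((Prog.iter n init body).run γ).2 ≤ (n.run γ).2 + (init.run γ).2 + 1 + k * (c + 1) := by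
  subst hk
  rw [Prog.run]
  exact iterate_step_count_snd_le (fun s : b.Val => body.run (s, γ)) c hstep _ _

open Classical in
theorem Prog.run_ifLe_fst {Γ : List Ty} {a : Ty} (s t : Prog Γ .real) (p q : Prog Γ a)
    (γ : Env Γ) : ((Prog.ifLe s t p q).run γ).1 =
      if (show ℝ from (s.run γ).1) ≤ (t.run γ).1 then (p.run γ).1 else (q.run γ).1 := by
  rw [Prog.run]
  dsimp only
  split_ifs <;> rfl

theorem Prog.run_ifIntLe_fst {Γ : List Ty} {a : Ty} (s t : Prog Γ .int) (p q : Prog Γ a)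
    (γ : Env Γ) : ((Prog.ifIntLe s t p q).run γ).1 =
      if (show ℤ from (s.run γ).1) ≤ (t.run γ).1 then (p.run γ).1 else (q.run γ).1 := by
  rw [Prog.run]
  dsimp only
  split_ifs <;> rfl

theorem Prog.run_ifLe_snd_le {Γ : List Ty} {a : Ty} (s t : Prog Γ .real) (p q : Prog Γ a)
    (γ : Env Γ) : ((Prog.ifLe s t p q).run γ).2 ≤
      (s.run γ).2 + (t.run γ).2 + max (p.run γ).2 (q.run γ).2 + 1 := by
  rw [Prog.run]
  dsimp only
  split_ifs <;> simp

theorem Prog.run_ifIntLe_snd_le {Γ : List Ty} {a : Ty} (s t : Prog Γ .int) (p q : Prog Γ a)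
    (γ : Env Γ) : ((Prog.ifIntLe s t p q).run γ).2 ≤
      (s.run γ).2 + (t.run γ).2 + max (p.run γ).2 (q.run γ).2 + 1 := by
  rw [Prog.run]
  dsimp only
  split_ifs <;> simp

/-! ### The programs -/

namespace FGT

/-- A cell coordinate and an index, with the corresponding factor of the value, the contribution
to the squared distance from the cell center, and `intervalDistSq` and `intervalFlag`. -/
abbrev optTy : Ty :=
  .prod (.prod .int .int) (.prod .real (.prod .real (.prod .real .int)))

/-- A cell and a multi-index, with the products and sums of the data in `optTy`. -/
abbrev partTy : Ty :=
  .prod (.prod (.list .int) (.list .int)) (.prod .real (.prod .real (.prod .real .int)))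

abbrev coordTy : Ty := .prod .real .real

/-- The variables for the treatment of one coordinate: the coordinates of the point and of the
center of the ball, the list of partial entries, and the input. -/
abbrev coordCtx : List Ty := coordTy :: .list partTy :: fgtInputTy

/-- The state of the loop over the indices: the index `r`, the factors for `r` and for `r - 1`, and
the choices collected so far. -/
abbrev loopTy : Ty := .prod (.prod .int .real) (.prod .real (.list optTy))

section
variable {Γ : List Ty} {a b c e : Ty}
abbrev v0 : Prog (a :: Γ) a := .var .zero
abbrev v1 : Prog (b :: a :: Γ) a := .var (.succ .zero)
abbrev v2 : Prog (c :: b :: a :: Γ) a := .var (.succ (.succ .zero))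
abbrev v3 : Prog (e :: c :: b :: a :: Γ) a := .var (.succ (.succ (.succ .zero)))
abbrev realLit (n : ℤ) : Prog Γ .real := .toReal (.intLit n)
end

/-- The list of pairs `(x j, p j)`, in reverse order. -/
def revZip : Prog fgtInputTy (.list coordTy) :=
  .snd (.fold (b := .prod (.list .real) (.list coordTy)) v0 (.pair v1 .nil)
    (.caseList (.fst v1) v1 (.pair v1 (.cons (.pair v2 v0) (.snd v3)))))

/-- `intervalDistSq m p` and `intervalFlag m p`. -/
def distProg {Γ : List Ty} (m : Prog Γ .int) (p : Prog Γ .real) : Prog Γ (.prod .real .int) :=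
  .ifLe (.add (.toReal m) (realLit 1)) p
    (.pair (.mul (.sub p (.add (.toReal m) (realLit 1))) (.sub p (.add (.toReal m) (realLit 1))))
      (.intLit 1))
    (.ifLe (.toReal m) p (.pair (realLit 0) (.intLit 0))
      (.pair (.mul (.sub p (.toReal m)) (.sub p (.toReal m))) (.intLit 0)))

/-- One more index for a fixed cell coordinate. The parameter `b` says whether `g` is to be
computed, or else `f`. -/
def indexBody (b : Bool) :
    Prog (loopTy :: .real :: .prod .int (.list optTy) :: coordCtx) loopTy :=
  .pair
    (.pair (.intAdd (.fst (.fst v0)) (.intLit 1))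
      (if b then
        -- Recurrence for `h_r(u) / r!`, which yields each factor from the previous two in constant
        -- time.
        .div (.sub (.mul (.mul (realLit 2) v1) (.snd (.fst v0)))
          (.mul (realLit 2) (.fst (.snd v0)))) (.add (.toReal (.fst (.fst v0))) (realLit 1))
      else .mul (.snd (.fst v0)) v1))
    (.pair (.snd (.fst v0))
      (.cons
        (.pair (.pair (.fst v2) (.fst (.fst v0)))
          (.pair (.snd (.fst v0)) (.pair (if b then .mul v1 v1 else realLit 0)
            (distProg (.fst v2) (.snd v3)))))
        (.snd (.snd v0))))

/-- One more cell coordinate. -/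
def cellBody (b : Bool) :
    Prog (.prod .int (.list optTy) :: coordCtx) (.prod .int (.list optTy)) :=
  .letIn (.sub (.fst v1) (.add (.toReal (.fst v0)) (.div (realLit 1) (realLit 2))))
    (.pair (.intAdd (.fst v1) (.intLit 1))
      (.snd (.snd (.iter
        (.intAdd (.var (.succ (.succ (.succ (.succ (.succ (.succ (.succ .zero)))))))) (.intLit 1))
        (.pair
          (.pair (.intLit 0)
            (if b then .exp (.sub (realLit 0) (.mul v0 v0)) else realLit 1))
          (.pair (realLit 0) (.snd v1)))
        (indexBody b)))))

/-- All choices of a cell coordinate and an index for one coordinate. -/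
def optsProg (b : Bool) : Prog coordCtx (.list optTy) :=
  let ρ : Prog coordCtx .int := .var (.succ (.succ (.succ (.succ (.succ .zero)))))
  .snd (.iter (if b then .intAdd (.intAdd ρ ρ) (.intLit 3) else .intLit 1)
    (.pair
      (if b then .intSub (.floor (.fst v0)) (.intAdd ρ (.intLit 1)) else .floor (.fst v0)) .nil)
    (cellBody b))

def combineProg : Prog (partTy :: .list partTy :: optTy :: .list partTy :: coordCtx)
    (.list partTy) :=
  .cons
    (.pair
      (.pair (.cons (.fst (.fst v2)) (.fst (.fst v0))) (.cons (.snd (.fst v2)) (.snd (.fst v0))))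
      (.pair (.mul (.fst (.snd v2)) (.fst (.snd v0)))
        (.pair (.add (.fst (.snd (.snd v2))) (.fst (.snd (.snd v0))))
          (.pair (.add (.fst (.snd (.snd (.snd v2)))) (.fst (.snd (.snd (.snd v0)))))
            (.intAdd (.snd (.snd (.snd (.snd v2)))) (.snd (.snd (.snd (.snd v0)))))))))
    v1

/-- All combinations of partial entries with choices for one more coordinate. -/
def stepProg (b : Bool) : Prog coordCtx (.list partTy) :=
  .fold (optsProg b) .nil (.fold v3 v1 combineProg)

def partsProg (b : Bool) : Prog fgtInputTy (.list partTy) :=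
  .fold revZip
    (.cons (.pair (.pair .nil .nil)
      (.pair (realLit 1) (.pair (realLit 0) (.pair (realLit 0) (.intLit 0))))) .nil)
    (stepProg b)

/-- Keeps an entry if its cell center is within the cutoff (automatic for `f`, where that sum is
`0`) and its cell meets the ball, by the criterion of `mem_ballCells_iff`. -/
def filterProg : Prog (partTy :: sparseTy :: fgtInputTy) sparseTy :=
  let D : Prog (partTy :: sparseTy :: fgtInputTy) .real := .fst (.snd (.snd (.snd v0)))
  let Φ : Prog (partTy :: sparseTy :: fgtInputTy) .real :=
    .var (.succ (.succ (.succ (.succ .zero))))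
  let keep : Prog (partTy :: sparseTy :: fgtInputTy) sparseTy :=
    .cons (.pair (.fst v0) (.fst (.snd v0))) v1
  .ifLe (.fst (.snd (.snd v0))) (.toReal (.var (.succ (.succ (.succ (.succ (.succ .zero)))))))
    (.ifIntLe (.snd (.snd (.snd (.snd v0)))) (.intLit 0)
      (.ifLe D (.mul Φ Φ) keep v1) (.ifLe (.mul Φ Φ) D v1 keep))
    v1

/-- The program for `g` if `b` is true, and for `f` otherwise. -/
def mainProg (b : Bool) : Prog fgtInputTy sparseTy :=
  .fold (partsProg b) .nil filterProg

/-! ### Their values -/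

/-- One factor of an entry of `f` or `g`. -/
noncomputable def coef (b : Bool) (r : ℕ) (u : ℝ) : ℝ :=
  if b then 1 / (r.factorial : ℝ) * hermiteFun r u else u ^ r

/-- One summand of the squared distance to the cell center, which matters for `g` only. -/
noncomputable def sqContrib (b : Bool) (u : ℝ) : ℝ := if b then u * u else 0

noncomputable def opt (b : Bool) (c : ℝ × ℝ) (m : ℤ) (r : ℕ) : optTy.Val :=
  ((m, (r : ℤ)), coef b r (c.1 - (m + 1 / 2)),
    sqContrib b (c.1 - (m + 1 / 2)), intervalDistSq m c.2, intervalFlag m c.2)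

noncomputable def firstCell (b : Bool) (ρ : ℕ) (x : ℝ) : ℤ := if b then ⌊x⌋ - (ρ + 1) else ⌊x⌋

def numCells (b : Bool) (ρ : ℕ) : ℕ := if b then 2 * ρ + 3 else 1

noncomputable def opts (b : Bool) (ρ : ℕ) (c : ℝ × ℝ) : List optTy.Val :=
  ((List.range (numCells b ρ)).flatMap fun i : ℕ =>
    (List.range (ρ + 1)).map (opt b c (firstCell b ρ c.1 + i))).reverse

noncomputable def combine (o : optTy.Val) (e : partTy.Val) : partTy.Val :=
  ((o.1.1 :: e.1.1, o.1.2 :: e.1.2), o.2.1 * e.2.1, o.2.2.1 + e.2.2.1, o.2.2.2.1 + e.2.2.2.1,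
    o.2.2.2.2 + e.2.2.2.2)

noncomputable def step (os : List optTy.Val) (L : List partTy.Val) : List partTy.Val :=
  (os.flatMap fun o => L.map (combine o)).reverse

noncomputable def unitPart : partTy.Val := (([], []), 1, 0, 0, 0)

noncomputable def parts (b : Bool) (ρ : ℕ) (cs : List (ℝ × ℝ)) : List partTy.Val :=
  cs.foldr (fun c L => step (opts b ρ c) L) [unitPart]

def Passes (ρ : ℕ) (Φ : ℝ) (e : partTy.Val) : Prop :=
  e.2.2.1 ≤ ρ ∧ if e.2.2.2.2 ≤ 0 then e.2.2.2.1 ≤ Φ ^ 2 else ¬ Φ ^ 2 ≤ e.2.2.2.1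

open Classical in
noncomputable def output (ρ : ℕ) (Φ : ℝ) (L : List partTy.Val) :
    List ((List ℤ × List ℤ) × ℝ) :=
  ((L.filter fun e => Passes ρ Φ e).map fun e => (e.1, e.2.1)).reverse

theorem run_distProg_fst {Γ : List Ty} (m : Prog Γ .int) (p : Prog Γ .real) (γ : Env Γ) :
    ((distProg m p).run γ).1 =
      (intervalDistSq (m.run γ).1 (p.run γ).1, intervalFlag (m.run γ).1 (p.run γ).1) := by
  simp only [distProg, Prog.run, intervalDistSq, intervalFlag, Int.cast_one, Int.cast_zero]
  split_ifs <;> simp [pow_two]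

theorem run_distProg_snd_le {Γ : List Ty} (m : Prog Γ .int) (p : Prog Γ .real) (γ : Env Γ) :
    ((distProg m p).run γ).2 ≤ 30 + 4 * (m.run γ).2 + 4 * (p.run γ).2 := by
  refine (Prog.run_ifLe_snd_le _ _ _ _ _).trans ?_
  have h := Prog.run_ifLe_snd_le (.toReal m) p (.pair (realLit 0) (.intLit 0))
    (.pair (.mul (.sub p (.toReal m)) (.sub p (.toReal m))) (.intLit 0)) γ
  simp only [Prog.run] at h ⊢
  omega

theorem run_indexBody_fst (b : Bool) (r : ℤ) (v w : ℝ) (acc : List optTy.Val) (u : ℝ) (m : ℤ)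
    (acc' : List optTy.Val) (c : ℝ × ℝ) (γ : Env (.list partTy :: fgtInputTy)) :
    ((indexBody b).run (((r, v), w, acc), u, (m, acc'), c, γ)).1 =
      ((r + 1, if b then (2 * u * v - 2 * w) / (r + 1) else v * u), v,
        ((m, r), v, sqContrib b u, intervalDistSq m c.2, intervalFlag m c.2) :: acc) := by
  cases b <;> simp [indexBody, Prog.run, Var.get, run_distProg_fst, sqContrib]

theorem run_indexBody_snd_le (b : Bool)
    (γ : Env (loopTy :: .real :: .prod .int (.list optTy) :: coordCtx)) :
    ((indexBody b).run γ).2 ≤ 100 := by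
  have h := run_distProg_snd_le (Γ := loopTy :: .real :: .prod .int (.list optTy) :: coordCtx)
    (.fst v2) (.snd v3) γ
  simp only [Prog.run] at h
  cases b <;> simp [indexBody, Prog.run] <;> omega

theorem coef_zero (b : Bool) (u : ℝ) :
    coef b 0 u = if b then Real.exp (-u ^ 2) else 1 := by
  cases b <;> simp [coef, hermiteFun_zero]

theorem coef_one (u : ℝ) : coef true 1 u = 2 * u * coef true 0 u := by
  simp [coef, hermiteFun_one]

/-- The Hermite recurrence divided by `(r + 2)!`; the factor `r + 1` cancels. -/
theorem coef_add_two (r : ℕ) (u : ℝ) :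
    coef true (r + 2) u = (2 * u * coef true (r + 1) u - 2 * coef true r u) / (r + 2) := by
  have h1 : (r.factorial : ℝ) ≠ 0 := by positivity
  have h2 : (r : ℝ) + 1 ≠ 0 := by positivity
  have h3 : (r : ℝ) + 2 ≠ 0 := by positivity
  simp only [coef, if_true, hermiteFun_add_two, Nat.factorial_succ]
  push_cast
  rw [show (r : ℝ) + 1 + 1 = r + 2 by ring]
  field_simp

theorem coef_succ_false (r : ℕ) (u : ℝ) : coef false (r + 1) u = coef false r u * u := by
  simp [coef, pow_succ]

/-- The state of the loop over the indices after `k` rounds. -/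
theorem iterate_indexBody (b : Bool) (m : ℤ) (c : ℝ × ℝ) (acc acc' : List optTy.Val)
    (γ : Env (.list partTy :: fgtInputTy)) (k : ℕ) :
    (fun s : loopTy.Val => ((indexBody b).run (s, c.1 - (m + 1 / 2), (m, acc'), c, γ)).1)^[k]
      (((0 : ℤ), coef b 0 (c.1 - (m + 1 / 2))), (0 : ℝ), acc) =
      (((k : ℤ), coef b k (c.1 - (m + 1 / 2))),
        (if k = 0 then 0 else coef b (k - 1) (c.1 - (m + 1 / 2))),
        ((List.range k).map (opt b c m)).reverse ++ acc) := by
  induction k with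
  | zero => simp
  | succ k ih =>
    rw [Function.iterate_succ_apply', ih, run_indexBody_fst]
    set u := c.1 - (m + 1 / 2) with hu
    -- The initial "previous factor" `0` makes the general recurrence valid at `k = 0`, where it
    -- reads `h_1 = 2 * u * h_0`.
    have e1 : (if b then (2 * u * coef b k u - 2 * (if k = 0 then 0 else coef b (k - 1) u)) /
        (((k : ℤ) : ℝ) + 1) else coef b k u * u) = coef b (k + 1) u := by
      cases b
      · simp [coef_succ_false]
      · cases k with
        | zero => simp [coef_one]
        | succ k =>
          rw [coef_add_two]
          push_cast
          simp only [if_true]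
          congr 1
          ring
    rw [e1, List.range_succ]
    simp [opt, hu]

theorem run_cellBody_fst (b : Bool) (m : ℤ) (acc : List optTy.Val) (c : ℝ × ℝ)
    (L : List partTy.Val) (xs ps : List ℝ) (Φ : ℝ) (ρ : ℕ) :
    ((cellBody b).run ((m, acc), c, L, xs, ps, Φ, (ρ : ℤ), ())).1 =
      (m + 1, ((List.range (ρ + 1)).map (opt b c m)).reverse ++ acc) := by
  have h := iterate_indexBody b m c acc acc (L, xs, ps, Φ, (ρ : ℤ), ()) (ρ + 1)
  have e : ((ρ : ℤ) + 1).toNat = ρ + 1 := by omega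
  rw [coef_zero] at h
  rw [cellBody, Prog.run_letIn, Prog.run_pair, Prog.run_snd, Prog.run_snd]
  rw [Prog.run_iter_fst (ρ + 1) (((0 : ℤ), if b then Real.exp (-(c.1 - (m + 1 / 2)) ^ 2) else 1),
    (0 : ℝ), acc) (by simp [Prog.run, Var.get, e])
    (by cases b <;> simp [Prog.run, Var.get, pow_two])]
  have h' := congrArg (fun s : loopTy.Val => s.2.2) h
  cases b <;> simpa [Prog.run, Var.get] using h'

theorem iterate_cellBody (b : Bool) (m : ℤ) (c : ℝ × ℝ)
    (L : List partTy.Val) (xs ps : List ℝ) (Φ : ℝ) (ρ k : ℕ) :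
    (fun s : (Ty.prod .int (.list optTy)).Val =>
      ((cellBody b).run (s, c, L, xs, ps, Φ, (ρ : ℤ), ())).1)^[k] (m, []) =
      (m + k, ((List.range k).flatMap fun i : ℕ =>
        (List.range (ρ + 1)).map (opt b c (m + i))).reverse) := by
  induction k with
  | zero => simp
  | succ k ih =>
    rw [Function.iterate_succ_apply', ih, run_cellBody_fst, List.range_succ (n := k),
      List.flatMap_append, List.reverse_append]
    simp [add_assoc]

theorem run_optsProg_fst (b : Bool) (c : ℝ × ℝ) (L : List partTy.Val) (xs ps : List ℝ) (Φ : ℝ)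
    (ρ : ℕ) : ((optsProg b).run (c, L, xs, ps, Φ, (ρ : ℤ), ())).1 = opts b ρ c := by
  rw [optsProg, Prog.run_snd]
  have e : ((ρ : ℤ) + ρ + 3).toNat = 2 * ρ + 3 := by omega
  rw [Prog.run_iter_fst (numCells b ρ) (firstCell b ρ c.1, [])
    (by cases b <;> simp [Prog.run, Var.get, numCells, e])
    (by cases b <;> simp [Prog.run, Var.get, firstCell])]
  exact congrArg Prod.snd (iterate_cellBody b (firstCell b ρ c.1) c L xs ps Φ ρ (numCells b ρ))

theorem foldl_foldl_cons {α β γ : Type*} (f : α → β → γ) (l : List α) (L : List β) (acc : List γ) :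
    l.foldl (fun acc o => L.foldl (fun acc e => f o e :: acc) acc) acc =
      (l.flatMap fun o => L.map (f o)).reverse ++ acc := by
  have h : ∀ (o : α) (L : List β) (acc : List γ),
      L.foldl (fun acc e => f o e :: acc) acc = (L.map (f o)).reverse ++ acc := by
    intro o L
    induction L with
    | nil => simp
    | cons e L ih => intro acc; simp [ih]
  induction l generalizing acc with
  | nil => simp
  | cons o l ih => rw [List.foldl_cons, ih, h]; simp

theorem run_combineProg_fst (e : partTy.Val) (acc : List partTy.Val) (o : optTy.Val)
    (γ : Env (.list partTy :: coordCtx)) :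
    (combineProg.run (e, acc, o, γ)).1 = combine o e :: acc := by
  simp [combineProg, Prog.run, Var.get, combine]

theorem run_stepProg_fst (b : Bool) (c : ℝ × ℝ) (L : List partTy.Val) (xs ps : List ℝ) (Φ : ℝ)
    (ρ : ℕ) : ((stepProg b).run (c, L, xs, ps, Φ, (ρ : ℤ), ())).1 = step (opts b ρ c) L := by
  rw [stepProg, Prog.run_fold_fst (opts b ρ c) []
    (fun acc o => L.foldl (fun acc e => combine o e :: acc) acc) (run_optsProg_fst ..) rfl
    fun acc o => Prog.run_fold_fst L acc _ rfl rfl fun acc' e => run_combineProg_fst ..,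
    foldl_foldl_cons, List.append_nil, step]

theorem run_revZip_fst (xs ps : List ℝ) (γ : Env [.real, .int]) :
    (revZip.run (xs, ps, γ)).1 = (xs.zip ps).reverse := by
  have h : ∀ (xs ps : List ℝ) (acc : List (ℝ × ℝ)),
      (xs.foldl (fun (s : List ℝ × List (ℝ × ℝ)) (x : ℝ) => match s.1 with
        | [] => s
        | q :: ps => (ps, (x, q) :: s.2)) (ps, acc)).2 = (xs.zip ps).reverse ++ acc := by
    intro xs
    induction xs with
    | nil => intros; simp
    | cons x xs ih => intro ps acc; cases ps <;> simp [ih]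
  rw [revZip, Prog.run_snd, Prog.run_fold_fst xs (ps, []) _ rfl rfl]
  · exact (h xs ps []).trans (List.append_nil _)
  · rintro ⟨ps, acc⟩ x
    cases ps <;> simp [Prog.run, Var.get]

/-- A left fold over the reversed coordinates is a right fold over the original ones, so prepending
builds the cells and multi-indices in the right order. -/
theorem run_partsProg_fst (b : Bool) (xs ps : List ℝ) (Φ : ℝ) (ρ : ℕ) :
    ((partsProg b).run (xs, ps, Φ, (ρ : ℤ), ())).1 = parts b ρ (xs.zip ps) := by
  rw [partsProg, Prog.run_fold_fst _ [unitPart] (fun L c => step (opts b ρ c) L)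
    (run_revZip_fst ..) (by simp [Prog.run, unitPart]) fun L c => run_stepProg_fst .., parts,
    List.foldl_reverse]

open Classical in
theorem run_filterProg_fst (e : partTy.Val) (acc : List ((List ℤ × List ℤ) × ℝ))
    (xs ps : List ℝ) (Φ : ℝ) (ρ : ℕ) :
    (filterProg.run (e, acc, xs, ps, Φ, (ρ : ℤ), ())).1 =
      if Passes ρ Φ e then (e.1, e.2.1) :: acc else acc := by
  simp only [filterProg, Prog.run_ifLe_fst, Prog.run_ifIntLe_fst]
  simp only [Prog.run, Var.get, Passes, pow_two, Int.cast_natCast]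
  by_cases h1 : e.2.2.1 ≤ (ρ : ℝ) <;> by_cases h2 : e.2.2.2.2 ≤ 0
  · by_cases h3 : e.2.2.2.1 ≤ Φ * Φ <;> simp [h1, h2, h3]
  · by_cases h3 : Φ * Φ ≤ e.2.2.2.1 <;> simp [h1, h2, h3]
  · simp [h1]
  · simp [h1]

theorem run_mainProg_fst (b : Bool) (xs ps : List ℝ) (Φ : ℝ) (ρ : ℕ) :
    ((mainProg b).run (xs, ps, Φ, (ρ : ℤ), ())).1 = output ρ Φ (parts b ρ (xs.zip ps)) := by
  classical
  have h : ∀ (L : List partTy.Val) (acc : List ((List ℤ × List ℤ) × ℝ)),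
      L.foldl (fun acc e => if Passes ρ Φ e then (e.1, e.2.1) :: acc else acc) acc =
        output ρ Φ L ++ acc := by
    intro L
    induction L with
    | nil => simp [output]
    | cons e L ih =>
      intro acc
      rw [List.foldl_cons, ih]
      by_cases hp : Passes ρ Φ e <;> simp [output, hp]
  rw [mainProg, Prog.run_fold_fst _ [] _ (run_partsProg_fst ..) rfl
    fun acc e => run_filterProg_fst .., h, List.append_nil]

/-! ### Their running times -/

theorem length_opts (b : Bool) (ρ : ℕ) (c : ℝ × ℝ) :
    (opts b ρ c).length = numCells b ρ * (ρ + 1) := by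
  simp [opts]

theorem length_step (os : List optTy.Val) (L : List partTy.Val) :
    (step os L).length = os.length * L.length := by
  simp [step]

theorem length_parts (b : Bool) (ρ : ℕ) (cs : List (ℝ × ℝ)) :
    (parts b ρ cs).length = (numCells b ρ * (ρ + 1)) ^ cs.length := by
  induction cs with
  | nil => simp [parts]
  | cons c cs ih =>
    have : parts b ρ (c :: cs) = step (opts b ρ c) (parts b ρ cs) := rfl
    rw [this, length_step, length_opts, ih, List.length_cons, pow_succ']

theorem run_cellBody_snd_le (b : Bool) (s : (Ty.prod .int (.list optTy)).Val) (c : ℝ × ℝ)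
    (L : List partTy.Val) (xs ps : List ℝ) (Φ : ℝ) (ρ : ℕ) :
    ((cellBody b).run (s, c, L, xs, ps, Φ, (ρ : ℤ), ())).2 ≤ 200 * (ρ + 1) := by
  have e : ((ρ : ℤ) + 1).toNat = ρ + 1 := by omega
  rw [cellBody, Prog.run_letIn, Prog.run_pair, Prog.run_snd, Prog.run_snd]
  have h := fun u : ℝ => Prog.run_iter_snd_le (body := indexBody b)
    (n := .intAdd (.var (.succ (.succ (.succ (.succ (.succ (.succ (.succ .zero)))))))) (.intLit 1))
    (init := .pair
      (.pair (.intLit 0) (if b then .exp (.sub (realLit 0) (.mul v0 v0)) else realLit 1))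
      (.pair (realLit 0) (.snd v1))) (γ := (u, s, c, L, xs, ps, Φ, (ρ : ℤ), ()))
    (ρ + 1) 100 (by simp [Prog.run, Var.get, e]) fun _ => run_indexBody_snd_le b _
  have h' := h (c.1 - ((s.1 : ℤ) + ((1 : ℤ) : ℝ) / ((2 : ℤ) : ℝ)))
  cases b <;>
  · simp only [Prog.run, Var.get, if_true, Bool.false_eq_true, if_false] at h' ⊢
    omega

theorem run_optsProg_snd_le (b : Bool) (c : ℝ × ℝ)
    (L : List partTy.Val) (xs ps : List ℝ) (Φ : ℝ) (ρ : ℕ) :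
    ((optsProg b).run (c, L, xs, ps, Φ, (ρ : ℤ), ())).2 ≤ 300 * (numCells b ρ * (ρ + 1)) := by
  have e : ((ρ : ℤ) + ρ + 3).toNat = 2 * ρ + 3 := by omega
  have h1 : 1 ≤ numCells b ρ := by cases b <;> simp [numCells]
  have h2 : numCells b ρ ≤ numCells b ρ * (ρ + 1) := Nat.le_mul_of_pos_right _ (by omega)
  rw [optsProg, Prog.run_snd]
  refine (Nat.add_le_add_right (Prog.run_iter_snd_le (numCells b ρ) (200 * (ρ + 1))
    (by cases b <;> simp [Prog.run, Var.get, numCells, e])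
    fun s => run_cellBody_snd_le ..) 1).trans ?_
  have h3 : numCells b ρ * (200 * (ρ + 1) + 1) =
    200 * (numCells b ρ * (ρ + 1)) + numCells b ρ := by ring
  rw [h3]
  cases b <;>
  · simp only [Prog.run, if_true, Bool.false_eq_true, if_false]
    omega

theorem run_combineProg_snd_le (γ : Env (partTy :: .list partTy :: optTy :: .list partTy :: coordCtx)) :
    (combineProg.run γ).2 ≤ 60 := by
  simp [combineProg, Prog.run]

theorem run_stepProg_snd_le (b : Bool) (c : ℝ × ℝ)
    (L : List partTy.Val) (hL : 1 ≤ L.length) (xs ps : List ℝ) (Φ : ℝ) (ρ : ℕ) :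
    ((stepProg b).run (c, L, xs, ps, Φ, (ρ : ℤ), ())).2 ≤
      500 * (numCells b ρ * (ρ + 1) * L.length) := by
  rw [stepProg]
  have h := run_optsProg_snd_le b c L xs ps Φ ρ
  -- Each outer round is an inner loop over `L`: `3` steps to set it up and at most `60 + 1` per
  -- round.
  refine (Prog.run_fold_snd_le (fun _ _ => True) (3 + L.length * 61) (opts b ρ c)
    (run_optsProg_fst ..) trivial fun k acc o _ _ _ => ⟨trivial, ?_⟩).trans ?_
  · refine (Prog.run_fold_snd_le (fun _ _ => True) 60 L rfl trivial
      fun k acc e _ _ _ => ⟨trivial, run_combineProg_snd_le _⟩).trans ?_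
    simp [Prog.run]
  · rw [length_opts]
    have h1 : 1 ≤ numCells b ρ := by cases b <;> simp [numCells]
    have h2 : 1 ≤ numCells b ρ * (ρ + 1) := Nat.mul_pos h1 (by omega)
    generalize numCells b ρ * (ρ + 1) = N at *
    have h3 : N ≤ N * L.length := Nat.le_mul_of_pos_right _ hL
    have h4 : N * (3 + L.length * 61 + 1) = 4 * N + 61 * (N * L.length) := by ring
    simp only [Prog.run]
    omega

theorem run_revZip_snd_le (xs ps : List ℝ) (γ : Env [.real, .int]) :
    (revZip.run (xs, ps, γ)).2 ≤ 10 + 20 * xs.length := by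
  rw [revZip, Prog.run_snd]
  refine (Nat.add_le_add_right (Prog.run_fold_snd_le (fun _ _ => True) 15 xs rfl trivial ?_) 1).trans ?_
  · rintro k ⟨ps, acc⟩ x - - -
    refine ⟨trivial, ?_⟩
    cases ps <;> simp [Prog.run, Var.get]
  · simp only [Prog.run]
    omega

theorem run_partsProg_snd_le (b : Bool) (xs ps : List ℝ) (h : xs.length = ps.length) (Φ : ℝ)
    (ρ : ℕ) : ((partsProg b).run (xs, ps, Φ, (ρ : ℤ), ())).2 ≤
      30 + 20 * xs.length + xs.length * (500 * (numCells b ρ * (ρ + 1)) ^ xs.length + 1) := by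
  have h1 : 1 ≤ numCells b ρ := by cases b <;> simp [numCells]
  have h2 : 0 < numCells b ρ * (ρ + 1) := Nat.mul_pos h1 (by omega)
  have hz := run_revZip_snd_le xs ps (Φ, (ρ : ℤ), ())
  have hlen : (xs.zip ps).reverse.length = xs.length := by simp [h]
  rw [partsProg]
  refine (Prog.run_fold_snd_le
    -- The invariant is the exact length of the list; the cost of every round is then bounded by
    -- that of the last.
    (fun k L => List.length (α := partTy.Val) L = (numCells b ρ * (ρ + 1)) ^ k)
    (500 * (numCells b ρ * (ρ + 1)) ^ xs.length) (xs.zip ps).reverse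
    (run_revZip_fst ..) (by simp [Prog.run]) ?_).trans ?_
  · intro k L c _ hk hL
    rw [hlen] at hk
    refine ⟨?_, (run_stepProg_snd_le b c L (by rw [hL]; exact Nat.pow_pos h2) ..).trans ?_⟩
    · rw [run_stepProg_fst, length_step, length_opts, hL, pow_succ']
    · rw [hL, ← pow_succ']
      exact Nat.mul_le_mul_left _ (Nat.pow_le_pow_right h2 hk)
  · rw [hlen]
    simp only [Prog.run]
    omega

theorem run_filterProg_snd_le (γ : Env (partTy :: sparseTy :: fgtInputTy)) :
    (filterProg.run γ).2 ≤ 60 := by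
  rw [filterProg]
  refine (Prog.run_ifLe_snd_le _ _ _ _ _).trans ?_
  have h := fun (s t : Prog (partTy :: sparseTy :: fgtInputTy) .int) p q =>
    Prog.run_ifIntLe_snd_le (a := sparseTy) s t p q γ
  have h' := fun (s t : Prog (partTy :: sparseTy :: fgtInputTy) .real) p q =>
    Prog.run_ifLe_snd_le (a := sparseTy) s t p q γ
  refine (Nat.add_le_add_right (Nat.add_le_add_left (max_le_max_right _ ((h _ _ _ _).trans
    (Nat.add_le_add_right (Nat.add_le_add_left (max_le_max (h' _ _ _ _) (h' _ _ _ _)) _) _)))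
    _) _).trans ?_
  simp [Prog.run]

theorem run_mainProg_snd_le (b : Bool) (xs ps : List ℝ) (h : xs.length = ps.length)
    (hxs : 1 ≤ xs.length) (Φ : ℝ) (ρ : ℕ) :
    ((mainProg b).run (xs, ps, Φ, (ρ : ℤ), ())).2 ≤
      xs.length * (700 * ((2 * ρ + 3) * (ρ + 1)) ^ xs.length) := by
  have h1 : numCells b ρ ≤ 2 * ρ + 3 := by cases b <;> simp [numCells]
  have hp := run_partsProg_snd_le b xs ps h Φ ρ
  rw [mainProg]
  refine (Prog.run_fold_snd_le (fun _ _ => True) 60 (parts b ρ (xs.zip ps))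
    (run_partsProg_fst ..) trivial fun k acc e _ _ _ => ⟨trivial, run_filterProg_snd_le _⟩).trans ?_
  have hlen : (xs.zip ps).length = xs.length := by simp [h]
  rw [length_parts, hlen]
  have h2 : (numCells b ρ * (ρ + 1)) ^ xs.length ≤ ((2 * ρ + 3) * (ρ + 1)) ^ xs.length :=
    Nat.pow_le_pow_left (Nat.mul_le_mul_right _ h1) _
  have h3 : 1 ≤ ((2 * ρ + 3) * (ρ + 1)) ^ xs.length := Nat.pow_pos (by positivity)
  simp only [Prog.run]
  generalize ((2 * ρ + 3) * (ρ + 1)) ^ xs.length = M at *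
  generalize (numCells b ρ * (ρ + 1)) ^ xs.length = N at *
  generalize xs.length = n at *
  nlinarith [Nat.mul_le_mul_left n h2, Nat.mul_le_mul hxs h3, Nat.mul_le_mul_left n h3,
    Nat.mul_le_mul_right M hxs]

/-! ### Correctness -/

/-- The cell coordinates that the program considers for a coordinate `x` of the point. -/
def Candidate (b : Bool) (ρ : ℕ) (x : ℝ) (m : ℤ) : Prop :=
  ∃ i < numCells b ρ, firstCell b ρ x + (i : ℕ) = m

/-- The partial entry for a cell and a multi-index. -/
noncomputable def part {d : ℕ} (b : Bool) (c : Fin d → ℝ × ℝ) (m : Fin d → ℤ) (r : Fin d → ℕ) :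
    partTy.Val :=
  ((List.ofFn m, List.ofFn fun j => (r j : ℤ)), ∏ j, coef b (r j) ((c j).1 - (m j + 1 / 2)),
    ∑ j, sqContrib b ((c j).1 - (m j + 1 / 2)), ∑ j, intervalDistSq (m j) (c j).2,
    ∑ j, intervalFlag (m j) (c j).2)

theorem mem_opts_iff (b : Bool) (ρ : ℕ) (c : ℝ × ℝ) (o : optTy.Val) :
    o ∈ opts b ρ c ↔ ∃ m r, (Candidate b ρ c.1 m ∧ r ≤ ρ) ∧ o = opt b c m r := by
  simp only [opts, List.mem_reverse, List.mem_flatMap, List.mem_range, List.mem_map, Candidate]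
  constructor
  · rintro ⟨i, hi, r, hr, rfl⟩
    exact ⟨_, r, ⟨⟨i, hi, rfl⟩, by omega⟩, rfl⟩
  · rintro ⟨m, r, ⟨⟨i, hi, rfl⟩, hr⟩, rfl⟩
    exact ⟨i, hi, r, by omega, rfl⟩

theorem mem_step_iff (os : List optTy.Val) (L : List partTy.Val) (e : partTy.Val) :
    e ∈ step os L ↔ ∃ o ∈ os, ∃ e' ∈ L, combine o e' = e := by
  simp [step]

theorem combine_opt_part {d : ℕ} (b : Bool) (c : Fin (d + 1) → ℝ × ℝ) (m : Fin (d + 1) → ℤ)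
    (r : Fin (d + 1) → ℕ) :
    combine (opt b (c 0) (m 0) (r 0))
      (part b (fun j => c j.succ) (fun j => m j.succ) (fun j => r j.succ)) = part b c m r := by
  simp [combine, opt, part, List.ofFn_succ, Fin.prod_univ_succ, Fin.sum_univ_succ]

theorem mem_parts_iff {d : ℕ} (b : Bool) (ρ : ℕ) (c : Fin d → ℝ × ℝ) (e : partTy.Val) :
    e ∈ parts b ρ (List.ofFn c) ↔ ∃ (m : Fin d → ℤ) (r : Fin d → ℕ),
      (∀ j, Candidate b ρ (c j).1 (m j) ∧ r j ≤ ρ) ∧ e = part b c m r := by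
  induction d generalizing e with
  | zero => simp [parts, part, unitPart]
  | succ d ih =>
    have h : parts b ρ (List.ofFn c) =
        step (opts b ρ (c 0)) (parts b ρ (List.ofFn fun j => c j.succ)) := by
      rw [List.ofFn_succ]; rfl
    rw [h, mem_step_iff]
    constructor
    · rintro ⟨o, ho, e', he', rfl⟩
      obtain ⟨m0, r0, h0, rfl⟩ := (mem_opts_iff ..).1 ho
      obtain ⟨m, r, h1, rfl⟩ := (ih ..).1 he'
      refine ⟨Fin.cons m0 m, Fin.cons r0 r, Fin.cases (by simpa using h0) (by simpa using h1), ?_⟩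
      exact combine_opt_part b c (Fin.cons m0 m) (Fin.cons r0 r)
    · rintro ⟨m, r, h1, rfl⟩
      exact ⟨_, (mem_opts_iff ..).2 ⟨m 0, r 0, h1 0, rfl⟩, _,
        (ih ..).2 ⟨_, _, fun j => h1 j.succ, rfl⟩, combine_opt_part b c m r⟩

/-- Keys in a product list are distinct as soon as the key of a combination determines the keys of
both components. -/
theorem nodup_map_flatMap {α β γ κ κ₁ κ₂ : Type*} (l : List α) (L : List β) (f : α → β → γ)
    (k : γ → κ) (k₁ : α → κ₁) (k₂ : β → κ₂) (h₁ : (l.map k₁).Nodup) (h₂ : (L.map k₂).Nodup)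
    (hf : ∀ a b a' b', k (f a b) = k (f a' b') → k₁ a = k₁ a' ∧ k₂ b = k₂ b') :
    ((l.flatMap fun a => L.map (f a)).map k).Nodup := by
  rw [List.map_flatMap, List.nodup_flatMap]
  constructor
  · intro a _
    rw [List.map_map]
    rw [List.Nodup, List.pairwise_map] at h₂ ⊢
    exact h₂.imp fun h e => h (hf _ _ _ _ e).2
  · rw [List.Nodup, List.pairwise_map] at h₁
    refine h₁.imp fun h => ?_
    rw [Function.onFun, List.disjoint_left]
    intro x hx hx'
    simp only [List.map_map, List.mem_map, Function.comp_apply] at hx hx'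
    obtain ⟨b, _, rfl⟩ := hx
    obtain ⟨b', _, e⟩ := hx'
    exact h (hf _ _ _ _ e).1.symm

theorem nodup_opts (b : Bool) (ρ : ℕ) (c : ℝ × ℝ) : ((opts b ρ c).map Prod.fst).Nodup := by
  rw [opts, List.map_reverse, List.nodup_reverse]
  refine nodup_map_flatMap _ _ _ _ id id (by simpa using List.nodup_range)
    (by simpa using List.nodup_range) ?_
  intro i r i' r' h
  simpa [opt] using h

theorem nodup_parts (b : Bool) (ρ : ℕ) (cs : List (ℝ × ℝ)) :
    ((parts b ρ cs).map Prod.fst).Nodup := by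
  induction cs with
  | nil => simp [parts]
  | cons c cs ih =>
    have h : parts b ρ (c :: cs) = step (opts b ρ c) (parts b ρ cs) := rfl
    rw [h, step, List.map_reverse, List.nodup_reverse]
    refine nodup_map_flatMap _ _ _ _ Prod.fst Prod.fst (nodup_opts b ρ c) ih ?_
    rintro ⟨⟨m, r⟩, o⟩ ⟨⟨M, R⟩, e⟩ ⟨⟨m', r'⟩, o'⟩ ⟨⟨M', R'⟩, e'⟩ h
    simp only [combine, Prod.mk.injEq, List.cons.injEq] at h ⊢
    tauto

theorem zip_ofFn {α β : Type*} {d : ℕ} (f : Fin d → α) (g : Fin d → β) :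
    (List.ofFn f).zip (List.ofFn g) = List.ofFn fun j => (f j, g j) := by
  apply List.ext_getElem <;> simp

/-- The ball test is exact, so every surviving entry names a genuine coordinate. It remains to know
that the values of survivors are right (`hval`) and that no non-zero coordinate is lost (`hzero`).
-/
theorem represents_output {d : ℕ} (b : Bool) (p : EuclideanSpace ℝ (Fin d)) {Φ : ℝ} (hΦ : 0 < Φ)
    (ρ : ℕ) (x : EuclideanSpace ℝ (Fin d)) (v : FGTIndex p Φ ρ → ℝ)
    (hval : ∀ i : FGTIndex p Φ ρ, (∀ j, Candidate b ρ (x j) (i.1.1 j)) →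
      ∑ j, sqContrib b (x j - (i.1.1 j + 1 / 2)) ≤ ρ →
      v i = ∏ j, coef b (i.2 j) (x j - (i.1.1 j + 1 / 2)))
    (hzero : ∀ i : FGTIndex p Φ ρ, v i ≠ 0 → (∀ j, Candidate b ρ (x j) (i.1.1 j)) ∧
      ∑ j, sqContrib b (x j - (i.1.1 j + 1 / 2)) ≤ ρ) :
    Represents (output ρ Φ (parts b ρ (List.ofFn fun j => (x j, p j)))) v := by
  classical
  refine ⟨?_, ?_, ?_⟩
  · rw [output, List.map_reverse, List.nodup_reverse, List.map_map]
    exact (nodup_parts b ρ _).sublist (List.filter_sublist.map Prod.fst)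
  · intro e he
    simp only [output, List.mem_reverse, List.mem_map, List.mem_filter, decide_eq_true_eq] at he
    obtain ⟨e, ⟨he, hpass⟩, rfl⟩ := he
    obtain ⟨m, r, h, rfl⟩ := (mem_parts_iff ..).1 he
    have hm : m ∈ ballCells p Φ := (mem_ballCells_iff m p hΦ).2 hpass.2
    refine ⟨(⟨m, hm⟩, fun j => ⟨r j, Nat.lt_succ_of_le (h j).2⟩), rfl, ?_⟩
    exact hval _ (fun j => (h j).1) hpass.1
  · intro i hi
    obtain ⟨hc, hs⟩ := hzero i hi
    set e := part b (fun j => (x j, p j)) i.1.1 fun j => i.2 j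
    refine ⟨(e.1, e.2.1), ?_, rfl⟩
    simp only [output, List.mem_reverse, List.mem_map, List.mem_filter, decide_eq_true_eq]
    refine ⟨_, ⟨(mem_parts_iff ..).2 ⟨i.1.1, fun j => i.2 j,
        fun j => ⟨hc j, Nat.le_of_lt_succ (i.2 j).2⟩, rfl⟩, hs, ?_⟩, rfl⟩
    exact (mem_ballCells_iff i.1.1 p hΦ).1 i.1.2

theorem represents_fgtF {d : ℕ} (p : EuclideanSpace ℝ (Fin d)) {Φ : ℝ} (hΦ : 0 < Φ)
    (ρ : ℕ) (x : EuclideanSpace ℝ (Fin d)) :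
    Represents ((mainProg false).run (fgtInput p Φ ρ x)).1 (fgtF p Φ ρ x) := by
  rw [fgtInput, run_mainProg_fst, zip_ofFn]
  have hc : ∀ i : FGTIndex p Φ ρ, (∀ j, Candidate false ρ (x j) (i.1.1 j)) ↔ x ∈ gridCell i.1.1 := by
    intro i
    rw [mem_gridCell_iff, funext_iff]
    simp [Candidate, numCells, firstCell, cellOf, eq_comm]
  refine represents_output false p hΦ ρ x _ ?_ ?_
  · intro i hi _
    rw [fgtF, if_pos ((hc i).1 hi)]
    rfl
  · intro i hi
    refine ⟨(hc i).2 (by_contra fun h => hi (by rw [fgtF, if_neg h])), by simp [sqContrib]⟩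

theorem represents_fgtG {d : ℕ} (p : EuclideanSpace ℝ (Fin d)) {Φ : ℝ} (hΦ : 0 < Φ)
    (ρ : ℕ) (y : EuclideanSpace ℝ (Fin d)) :
    Represents ((mainProg true).run (fgtInput p Φ ρ y)).1 (fgtG p Φ ρ y) := by
  rw [fgtInput, run_mainProg_fst, zip_ofFn]
  have hs : ∀ m : Fin d → ℤ,
      ∑ j, sqContrib true (y j - (m j + 1 / 2)) = ‖y - cellCenter m‖ ^ 2 := by
    intro m
    rw [EuclideanSpace.norm_sq_eq]
    simp [sqContrib, cellCenter, pow_two]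
  refine represents_output true p hΦ ρ y _ ?_ ?_
  · intro i _ hi
    rw [hs] at hi
    rw [fgtG, if_pos hi]
    rfl
  · intro i hi
    have h : ‖y - cellCenter i.1.1‖ ^ 2 ≤ ρ := by_contra fun h => hi (by rw [fgtG, if_neg h])
    refine ⟨fun j => ?_, (hs _).trans_le h⟩
    obtain ⟨h1, h2⟩ := floor_sub_le_of_norm_sq_le h j
    refine ⟨(i.1.1 j - (⌊y j⌋ - (ρ + 1))).toNat, ?_, ?_⟩ <;> simp only [numCells, firstCell, if_true] <;>
      omega

theorem run_mainProg_fgtInput_snd_le {d : ℕ} (hd : 1 ≤ d) (b : Bool)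
    (p : EuclideanSpace ℝ (Fin d)) (Φ : ℝ) (ρ : ℕ) (x : EuclideanSpace ℝ (Fin d)) :
    ((mainProg b).run (fgtInput p Φ ρ x)).2 ≤ (1400 * ((2 * ρ + 3) * (ρ + 1))) ^ d := by
  have h := run_mainProg_snd_le b (List.ofFn fun j => x j) (List.ofFn fun j => p j) (by simp)
    (by simpa using hd) Φ ρ
  rw [List.length_ofFn] at h
  refine h.trans ?_
  have h1 : d ≤ 2 ^ d := Nat.lt_two_pow_self.le
  have h2 : 700 ≤ 700 ^ d := Nat.le_self_pow (by omega) _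
  calc _ ≤ 2 ^ d * (700 ^ d * ((2 * ρ + 3) * (ρ + 1)) ^ d) := by gcongr
    _ = _ := by rw [← mul_pow, ← mul_pow]; ring

end FGT

/-! ### The main theorem -/

/-- Needed to evaluate the integral against the Dirac measure without assuming that singletons of
pairs are measurable. -/
theorem measurable_dotProduct_LSQPair {E ι : Type*} [Fintype ι] {R : ℝ} {S : ℕ} (x y : E) :
    Measurable fun P : LSQPair E ι R S => P.f x ⬝ᵥ P.g y := by
  have h : Measurable fun P : LSQPair E ι R S => (P.f, P.g) := comap_measurable _
  have hf : ∀ i, Measurable fun P : LSQPair E ι R S => P.f x i := fun i =>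
    (measurable_pi_apply i).comp ((measurable_pi_apply x).comp h.fst)
  have hg : ∀ i, Measurable fun P : LSQPair E ι R S => P.g y i := fun i =>
    (measurable_pi_apply i).comp ((measurable_pi_apply y).comp h.snd)
  exact Finset.measurable_sum _ fun i _ => (hf i).mul (hg i)

/-- The Fast Gauss Transform pair. -/
noncomputable def fgtPair {d : ℕ} (p : EuclideanSpace ℝ (Fin d)) (Φ : ℝ) (ρ : ℕ) :
    LSQPair (EuclideanSpace ℝ (Fin d)) (FGTIndex p Φ ρ) (Real.exp 1 ^ d)
      (((2 * ρ + 3) * (ρ + 1)) ^ d) where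
  f := fgtF p Φ ρ
  g := fgtG p Φ ρ
  f_mem x i := abs_le.1 ((abs_fgtF_le_one p Φ ρ x i).trans
    (one_le_pow₀ (Real.one_le_exp zero_le_one)))
  g_mem y i := abs_le.1 (abs_fgtG_le p Φ ρ y i)
  f_sparse x := encard_fgtF_ne_zero_le p Φ ρ x
  g_sparse y := encard_fgtG_ne_zero_le p Φ ρ y

theorem card_FGTIndex {d : ℕ} (p : EuclideanSpace ℝ (Fin d)) (Φ : ℝ) (ρ : ℕ) :
    Fintype.card (FGTIndex p Φ ρ) = Fintype.card (ballCells p Φ) * (ρ + 1) ^ d := by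
  simp

/-! ### Choice of the truncation order and of the constants -/

theorem exp_neg_truncation_le {c L ρ : ℝ} {d : ℕ} (hc : 0 < c) (hL : 0 ≤ L) (hd : (d : ℝ) ≤ c * L)
    (hρ : (4 + 12 * c) * L ≤ ρ) : Real.exp (-(ρ / 2 - d / 4)) ≤ Real.exp (-L) := by
  have hcL := mul_nonneg hc.le hL
  apply Real.exp_le_exp.2
  linarith

/-- Since `2 ^ (-ρ) ≤ exp (-ρ / 2)`, the order `ρ` leaves `exp (-L)` and a spare factor `exp (-(L +
6 * c * L)) ≤ 1 / (6 * c * L)`. The latter cancels `d * e ≤ 3 * c * L` down to `1 / 2`, and `exp t -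
1 ≤ 2 * t` for `0 ≤ t ≤ 1` finishes. -/
theorem one_add_pow_sub_one_le {c L : ℝ} {d ρ : ℕ} (hc : 0 < c) (hL : 0 < L)
    (hd : (d : ℝ) ≤ c * L) (hρ : (4 + 12 * c) * L ≤ ρ) :
    (1 + Real.exp 1 * (1 / 2) ^ ρ) ^ d - 1 ≤ Real.exp (-L) := by
  have hcL := mul_pos hc hL
  have hhalf : (1 / 2 : ℝ) ^ ρ ≤ Real.exp (-L) * Real.exp (-(L + 6 * (c * L))) := by
    have h1 : (1 / 2 : ℝ) ≤ Real.exp (-(1 / 2)) := by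
      have := Real.add_one_le_exp (-(1 / 2) : ℝ)
      linarith
    calc (1 / 2 : ℝ) ^ ρ ≤ Real.exp (-(1 / 2)) ^ ρ := pow_le_pow_left₀ (by norm_num) h1 _
      _ = Real.exp (ρ * -(1 / 2)) := (Real.exp_nat_mul _ _).symm
      _ ≤ Real.exp (-L + -(L + 6 * (c * L))) := Real.exp_le_exp.2 (by nlinarith)
      _ = _ := Real.exp_add _ _
  have hsmall : Real.exp (-(L + 6 * (c * L))) ≤ 1 / (6 * (c * L)) := by
    rw [Real.exp_neg, ← one_div]
    apply one_div_le_one_div_of_le (by positivity)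
    have := Real.add_one_le_exp (L + 6 * (c * L))
    linarith
  have hdε : d * (Real.exp 1 * (1 / 2) ^ ρ) ≤ Real.exp (-L) / 2 := by
    calc d * (Real.exp 1 * (1 / 2) ^ ρ)
        ≤ (c * L) * (3 * (Real.exp (-L) * (1 / (6 * (c * L))))) := by
          have h3 : Real.exp 1 ≤ 3 := Real.exp_one_lt_d9.le.trans (by norm_num)
          have h4 : (1 / 2 : ℝ) ^ ρ ≤ Real.exp (-L) * (1 / (6 * (c * L))) :=
            hhalf.trans (mul_le_mul_of_nonneg_left hsmall (Real.exp_pos _).le)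
          gcongr
      _ = _ := by field_simp; norm_num
  have hL1 : Real.exp (-L) ≤ 1 := Real.exp_le_one_iff.2 (by linarith)
  have h0 : 0 ≤ d * (Real.exp 1 * (1 / 2 : ℝ) ^ ρ) := by positivity
  calc (1 + Real.exp 1 * (1 / 2) ^ ρ) ^ d - 1
      ≤ Real.exp (d * (Real.exp 1 * (1 / 2) ^ ρ)) - 1 := by
        rw [Real.exp_nat_mul]
        gcongr
        rw [add_comm]
        exact Real.add_one_le_exp _
    _ ≤ 2 * |d * (Real.exp 1 * (1 / 2 : ℝ) ^ ρ)| :=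
        (le_abs_self _).trans (Real.abs_exp_sub_one_le (by rw [abs_of_nonneg h0]; linarith))
    _ ≤ _ := by rw [abs_of_nonneg h0]; linarith

/-- A constant becomes a power of `L`: `A = e ^ log A ≤ L ^ log A` because `L ≥ e`. -/
theorem mul_sq_le_rpow {A L a : ℝ} (hA : 1 ≤ A) (hL : Real.exp 1 ≤ L) (ha : 2 + Real.log A ≤ a) :
    A * L ^ 2 ≤ L ^ a := by
  have hL0 : 0 < L := (Real.exp_pos 1).trans_le hL
  have hL1 : 1 ≤ L := (Real.one_le_exp zero_le_one).trans hL
  have h1 : A ≤ L ^ Real.log A := by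
    calc A = Real.exp 1 ^ Real.log A := by
          rw [← Real.exp_mul, one_mul, Real.exp_log (by linarith)]
      _ ≤ _ := Real.rpow_le_rpow (Real.exp_pos _).le hL (Real.log_nonneg hA)
  calc A * L ^ 2 ≤ L ^ Real.log A * L ^ (2 : ℝ) := by
        rw [← Real.rpow_natCast L 2]
        exact mul_le_mul_of_nonneg_right h1 (by positivity)
    _ = L ^ (Real.log A + 2) := (Real.rpow_add hL0 _ _).symm
    _ ≤ _ := Real.rpow_le_rpow_of_exponent_le hL1 (by linarith)

theorem mainTheorem8 :
    ∃ (F G : Prog fgtInputTy sparseTy) (α₀ B : ℝ), 0 < α₀ ∧ 0 < B ∧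
      ∀ c : ℝ, 0 < c → ∃ C : ℝ, 0 < C ∧
        ∀ (d : ℕ) (α : ℝ), 1 ≤ d → 0 < α → α < α₀ → (d : ℝ) ≤ c * Real.log (1 / α) →
          ∃ ρ : ℕ, (ρ : ℝ) ≤ C * Real.log (1 / α) ∧
            ∀ (p : EuclideanSpace ℝ (Fin d)) (Φ : ℝ), 0 < Φ →
              ∃ (Q : ℕ) (R : ℝ) (S : ℕ)
                (P : LSQPair (EuclideanSpace ℝ (Fin d)) (FGTIndex p Φ ρ) R S),
                (Q : ℝ) ≤ (C * ((1 + Φ / Real.sqrt d) * Real.log (1 / α))) ^ d ∧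
                R ≤ B ^ d ∧
                (S : ℝ) ≤ Real.log (1 / α) ^ (C * d) ∧
                P.f = fgtF p Φ ρ ∧
                P.g = fgtG p Φ ρ ∧
                IsLSQFamily α Q gaussianKernel (Metric.closedBall p Φ)
                  (MeasureTheory.Measure.dirac P) ∧
                EvaluatesInTime F p Φ ρ (fgtF p Φ ρ) (Real.log (1 / α) ^ (C * d)) ∧
                EvaluatesInTime G p Φ ρ (fgtG p Φ ρ) (Real.log (1 / α) ^ (C * d)) := by
  -- The threshold `exp (-3)` ensures `L > 3 > e`, so that constants can be absorbed into powers of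
  -- `L`.
  refine ⟨FGT.mainProg false, FGT.mainProg true, Real.exp (-3), Real.exp 1, Real.exp_pos _,
    Real.exp_pos _, fun c hc => ?_⟩
  set K : ℝ := 5 + 12 * c with hK
  have hK5 : 5 ≤ K := by linarith
  have hA : 1 ≤ 8400 * K ^ 2 := by nlinarith
  have hlogA := Real.log_nonneg hA
  -- The summand `10 * K` serves the bound on `Q`, as `5 * (2 * K)`; the rest serves the exponent
  -- for `S` and the time, with `8400 = 1400 * 3 * 2`.
  set C : ℝ := 10 * K + (2 + Real.log (8400 * K ^ 2)) with hC
  refine ⟨C, by positivity, fun d α hd hα hα₀ hdL => ?_⟩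
  set L := Real.log (1 / α) with hLdef
  have hαL : Real.exp (-L) = α := by
    rw [hLdef, one_div, Real.log_inv, neg_neg, Real.exp_log hα]
  have hL3 : 3 < L := by
    rw [← hαL, Real.exp_lt_exp] at hα₀
    linarith
  have hL0 : 0 < L := by linarith
  set ρ := ⌈(4 + 12 * c) * L⌉₊ with hρdef
  have hρ1 : (4 + 12 * c) * L ≤ ρ := Nat.le_ceil _
  have hρ2 : (ρ : ℝ) + 1 ≤ 2 * K * L ∧ (ρ : ℝ) ≤ K * L := by
    have := Nat.ceil_lt_add_one (a := (4 + 12 * c) * L) (by positivity)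
    rw [← hρdef] at this
    constructor <;> nlinarith
  have hT : ((1400 * ((2 * ρ + 3) * (ρ + 1))) ^ d : ℕ) ≤ L ^ (C * d) := by
    push_cast
    rw [Real.rpow_mul hL0.le, Real.rpow_natCast]
    refine pow_le_pow_left₀ (by positivity) ?_ d
    have hKL : 15 ≤ K * L := by nlinarith
    calc 1400 * ((2 * (ρ : ℝ) + 3) * (ρ + 1)) ≤ 1400 * ((3 * K * L) * (2 * K * L)) := by
          gcongr <;> linarith [hρ2.1, hρ2.2]
      _ = 8400 * K ^ 2 * L ^ 2 := by ring
      _ ≤ _ := mul_sq_le_rpow hA (Real.exp_one_lt_d9.le.trans (by linarith)) (by rw [hC]; linarith)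
  refine ⟨ρ, hρ2.2.trans (mul_le_mul_of_nonneg_right (by rw [hC]; linarith) hL0.le),
    fun p Φ hΦ => ⟨_, _, _, fgtPair p Φ ρ, ?_, le_rfl, ?_, rfl, rfl,
      ⟨inferInstance, by positivity, rfl, fun x hx y _ => ?_⟩, fun x => ⟨?_, ?_⟩,
      fun y => ⟨?_, ?_⟩⟩⟩
  · rw [card_FGTIndex]
    push_cast
    calc _ ≤ (5 * (1 + Φ / Real.sqrt d)) ^ d * (2 * K * L) ^ d := by
          gcongr
          · exact card_ballCells_le hd p hΦ
          · exact hρ2.1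
      _ = (10 * K * ((1 + Φ / Real.sqrt d) * L)) ^ d := by rw [← mul_pow]; ring
      _ ≤ _ := by
          gcongr
          rw [hC]; linarith
  · refine le_trans ?_ hT
    exact_mod_cast Nat.pow_le_pow_left (Nat.le_mul_of_pos_left _ (by norm_num)) d
  · rw [integral_dirac' _ _ (measurable_dotProduct_LSQPair x y).stronglyMeasurable]
    exact abs_gaussianKernel_sub_dotProduct_le p Φ ρ x y hx
      ((exp_neg_truncation_le hc hL0.le hdL hρ1).trans_eq hαL)
      ((one_add_pow_sub_one_le hc hL0 hdL hρ1).trans_eq hαL)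
  · exact FGT.represents_fgtF p hΦ ρ x
  · exact (Nat.cast_le.2 (FGT.run_mainProg_fgtInput_snd_le hd false p Φ ρ x)).trans hT
  · exact FGT.represents_fgtG p hΦ ρ y
  · exact (Nat.cast_le.2 (FGT.run_mainProg_fgtInput_snd_le hd true p Φ ρ y)).trans hT
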